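/- Let $F$ be an infinite field of characteristic $\neq 2$ and let $n\ge 3$. Let $T_n(F)$ be the group of invertible upper triangular $n\times n$ matrices over $F$, $UT_n(F)$ its subgroup of unitriangular matrices, $d_i(\alpha)$ the diagonal matrix with $\alpha\in F^\times$ in place $(i,i)$ and $1$ elsewhere on the diagonal, $B_n(F)=\prod_{i=1}^{n-1}d_i(F^\times)$, and $PT_n(F)=T_n(F)/Z(T_n(F))$. Write $d_i=d_i(-1)$ $(1\le i\le n)$ and $t_{ij}=I+E_{ij}$ $(i<j)$, and let $\bar{\mathcal T}^*$ be the tuple of the images of all $t_{ij}$ $(i<j)$ and all $d_i$ $(1\le i\le n)$ in $PT_n(F)$. (1) The map $(u,b)\mapsto ub\,Z(T_n(F))$ is an isomorphism $UT_n(F)\rtimes B_n(F)\to PT_n(F)$, where $B_n(F)$ acts on $UT_n(F)$ by conjugation. (2) The group $G=PT_n(F)$ is regularly bi-interpretable with the field $F$ with respect to the constants $\bar{\mathcal T}^*$. This means the following. For an interpretation code $\Gamma$ (a finite list of first-order formulas in the language of a structure $\mathcal B$, defining a set of tuples, an equivalence relation on it and relations for the basic operations), $\Gamma(\mathcal B,p)$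 denotes the structure interpreted by $\Gamma$ in $\mathcal B$ with parameters $p$; a coordinate map of $\mathcal A\simeq\Gamma(\mathcal B,p)$ is a surjection from the defining set of tuples onto $\mathcal A$ that induces an isomorphism $\Gamma(\mathcal B,p)\to\mathcal A$. There are a code $\Gamma$ and a formula $\varphi$ in the language of groups, a code $\Delta$ in the language of rings without parameters, and formulas $\theta_F$, $\theta_G$ in the languages of rings and of groups, such that: (a) $G\models\varphi(\bar{\mathcal T}^*)$, and $F\simeq\Gamma(G,p)$ for every tuple $p$ in $G$ with $G\models\varphi(p)$; moreover $G\simeq\Delta(F)$; (b) for every tuple $p^*$ in $\Delta(F)$ with $\Delta(F)\models\varphi(p^*)$ the formula $\theta_F$ with parameters $p^*$ defines in $F$ an isomorphism $\Gamma(\Delta(F),p^*)\to F$; (c) for every $p$ with $G\models\varphi(p)$ the formula $\theta_G$ with parameters $p$ defines in $G$ an isomorphism $\Delta(\Gamma(G,p))\to G$; (d) for every $p$ with $G\models\varphi(p)$ there are coordinate maps $f$ of $F\simeq\Gamma(G,p)$ and $g$ of $G\simeq\Delta(F)$ such that the composition $f\circ g$ (from $\Gamma(\Delta(F),g^{-1}(p))$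 to $F$) is defined in $F$ by $\theta_F$ with parameters $g^{-1}(p)$, i.e. any tuple in $F$ representing $p$ under $g$, and the composition $g\circ f$ (from $\Delta(\Gamma(G,p))$ to $G$) is defined in $G$ by $\theta_G$ with parameters $p$. -/

import Mathlib

attribute [local instance] FirstOrder.Ring.compatibleRingOfRing

namespace TriBi

/-! ### The first-order language of groups -/

/-- Function symbols of the language of groups. -/
inductive GroupFunc : ℕ → Type
  | mul : GroupFunc 2
  | inv : GroupFunc 1
  | one : GroupFunc 0

/-- The first-order language of groups: multiplication, inversion and the identity. -/
def groupLang : FirstOrder.Language.{0, 0} := ⟨GroupFunc, fun _ => Empty⟩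

/-- Every group is a structure in the language of groups. -/
instance groupStructure (G : Type*) [Group G] : groupLang.Structure G where
  funMap := fun {m} f =>
    match m, f with
    | _, GroupFunc.mul => fun x => x 0 * x 1
    | _, GroupFunc.inv => fun x => (x 0)⁻¹
    | _, GroupFunc.one => fun _ => 1
  RelMap := fun r _ => nomatch r

/-! ### Interpretations with parameters -/

/-- A code `Γ` of an interpretation of `L`-structures in `K`-structures, with parameters indexed by
`ι`: the dimension `dim`, a formula for the set of `dim`-tuples that is used, a formula for the
equivalence relation on it, and a formula for (the graph of) each symbol of `L`. -/
structure InterpCode (L K : FirstOrder.Language.{0, 0}) (ι : Type) where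
  dim : ℕ
  dom : K.Formula (ι ⊕ Fin dim)
  eqv : K.Formula (ι ⊕ (Fin dim ⊕ Fin dim))
  fn : ∀ {m : ℕ}, L.Functions m → K.Formula (ι ⊕ ((Fin m × Fin dim) ⊕ Fin dim))
  rel : ∀ {m : ℕ}, L.Relations m → K.Formula (ι ⊕ (Fin m × Fin dim))

/-- The definable set of tuples over `B` that represent elements of the structure `Γ(B, p)`. -/
def InterpCode.Dom {L K : FirstOrder.Language.{0, 0}} {ι : Type} (Γ : InterpCode L K ι)
    {B : Type*} [K.Structure B] (p : ι → B) : Set (Fin Γ.dim → B) :=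
  {x | Γ.dom.Realize (Sum.elim p x)}

/-- `μ` is a coordinate map of the interpretation `A ≃ Γ(B, p)`: it maps the definable set of tuples
onto `A`, its kernel is the relation defined by `Γ.eqv`, and it carries the relations defined by
the formulas of `Γ` to the basic functions and relations of `A`. Equivalently, `Γ(B, p)` is a
well-defined `L`-structure and `μ` induces an isomorphism from it onto `A`. -/
structure InterpCode.IsCoordinateMap {L K : FirstOrder.Language.{0, 0}} {ι : Type} (Γ : InterpCode L K ι)
    {A B : Type*} [L.Structure A] [K.Structure B] (p : ι → B) (μ : Γ.Dom p → A) : Prop where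
  surjective : Function.Surjective μ
  eqv_iff : ∀ x y : Γ.Dom p, Γ.eqv.Realize (Sum.elim p (Sum.elim x.1 y.1)) ↔ μ x = μ y
  fn_iff : ∀ {m : ℕ} (f : L.Functions m) (xs : Fin m → Γ.Dom p) (y : Γ.Dom p),
    (Γ.fn f).Realize (Sum.elim p (Sum.elim (fun k : Fin m × Fin Γ.dim => (xs k.1).1 k.2) y.1)) ↔
      FirstOrder.Language.Structure.funMap f (fun k => μ (xs k)) = μ y
  rel_iff : ∀ {m : ℕ} (r : L.Relations m) (xs : Fin m → Γ.Dom p),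
    (Γ.rel r).Realize (Sum.elim p (fun k : Fin m × Fin Γ.dim => (xs k.1).1 k.2)) ↔
      FirstOrder.Language.Structure.RelMap r (fun k => μ (xs k))

/-- `A` is regularly interpretable in `B` by the code `Γ` and the formula `φ`: the formula `φ`
defines a non-empty set of parameter tuples in `B`, and `A ≃ Γ(B, p)` for every `p` in it. -/
def RegularlyInterprets {L K : FirstOrder.Language.{0, 0}} {ι : Type} (A B : Type*)
    [L.Structure A] [K.Structure B] (Γ : InterpCode L K ι) (φ : K.Formula ι) : Prop :=
  (∃ p : ι → B, φ.Realize p) ∧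
    ∀ p : ι → B, φ.Realize p → ∃ f : Γ.Dom p → A, Γ.IsCoordinateMap p f

/-- Let `f` be a map from (tuples representing) `Γ(B, p)` to `A`, and `g` a map from `Δ(A, q)` to
`B`. The formula `θ` of the language of `A`, with parameters `q` and the entries of a tuple `pStar`
of elements representing parameters in `Δ(A, q)`, defines in `A` the graph of the composition of
`g` (applied entrywise) and `f`, which goes from `Γ(Δ(A, q), pStar)` to `A`. -/
def DefinesComposite {L K : FirstOrder.Language.{0, 0}} {ι κ : Type} {A B : Type*}
    [L.Structure A] [K.Structure B] (Γ : InterpCode L K ι) (Δ : InterpCode K L κ)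
    (θ : L.Formula (((ι × Fin Δ.dim) ⊕ κ) ⊕ ((Fin Γ.dim × Fin Δ.dim) ⊕ Unit)))
    {p : ι → B} (f : Γ.Dom p → A) {q : κ → A} (g : Δ.Dom q → B) (pStar : ι → Δ.Dom q) : Prop :=
  ∀ (x : Fin Γ.dim → Fin Δ.dim → A) (a : A),
    θ.Realize (Sum.elim (Sum.elim (fun k : ι × Fin Δ.dim => (pStar k.1).1 k.2) q)
        (Sum.elim (fun k : Fin Γ.dim × Fin Δ.dim => x k.1 k.2) (fun _ => a))) ↔
      ∃ (hx : ∀ i, x i ∈ Δ.Dom q) (hx' : (fun i => g ⟨x i, hx i⟩) ∈ Γ.Dom p),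
        f ⟨fun i => g ⟨x i, hx i⟩, hx'⟩ = a

/-- `A ≃ Γ(B, φ)` and `B ≃ Δ(A, ψ)` form a regular bi-interpretation of `A` and `B`, with the
isomorphisms between the structures and their self-interpretations defined by `θA`, `θB`. -/
structure IsRegularBiinterpretation {L K : FirstOrder.Language.{0, 0}} {ι κ : Type} (A B : Type*)
    [L.Structure A] [K.Structure B]
    (Γ : InterpCode L K ι) (φ : K.Formula ι) (Δ : InterpCode K L κ) (ψ : L.Formula κ)
    (θA : L.Formula (((ι × Fin Δ.dim) ⊕ κ) ⊕ ((Fin Γ.dim × Fin Δ.dim) ⊕ Unit)))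
    (θB : K.Formula (((κ × Fin Γ.dim) ⊕ ι) ⊕ ((Fin Δ.dim × Fin Γ.dim) ⊕ Unit))) : Prop where
  interpA : RegularlyInterprets A B Γ φ
  interpB : RegularlyInterprets B A Δ ψ
  /-- For all `q` in `ψ(A)` and all `pStar` in `φ(Δ(A, q))`, the formula `θA` with parameters
  `(pStar, q)` defines in `A` an isomorphism `Γ(Δ(A, q), pStar) ≃ A`. -/
  definableA : ∀ q : κ → A, ψ.Realize q → ∀ g : Δ.Dom q → B, Δ.IsCoordinateMap q g →
    ∀ pStar : ι → Δ.Dom q, φ.Realize (fun i => g (pStar i)) →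
      ∃ f : Γ.Dom (fun i => g (pStar i)) → A,
        Γ.IsCoordinateMap (fun i => g (pStar i)) f ∧ DefinesComposite Γ Δ θA f g pStar
  /-- For all `p` in `φ(B)` and all `qStar` in `ψ(Γ(B, p))`, the formula `θB` with parameters
  `(qStar, p)` defines in `B` an isomorphism `Δ(Γ(B, p), qStar) ≃ B`. -/
  definableB : ∀ p : ι → B, φ.Realize p → ∀ f : Γ.Dom p → A, Γ.IsCoordinateMap p f →
    ∀ qStar : κ → Γ.Dom p, ψ.Realize (fun j => f (qStar j)) →
      ∃ g : Δ.Dom (fun j => f (qStar j)) → B,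
        Δ.IsCoordinateMap (fun j => f (qStar j)) g ∧ DefinesComposite Δ Γ θB g f qStar
  /-- For all `p` in `φ(B)` and `q` in `ψ(A)` there are coordinate maps of the two interpretations
  both of whose compositions are defined by `θA` and `θB`. -/
  coherent : ∀ (p : ι → B) (q : κ → A), φ.Realize p → ψ.Realize q →
    ∃ (f : Γ.Dom p → A) (g : Δ.Dom q → B), Γ.IsCoordinateMap p f ∧ Δ.IsCoordinateMap q g ∧
      (∀ pStar : ι → Δ.Dom q, (∀ i, g (pStar i) = p i) → DefinesComposite Γ Δ θA f g pStar) ∧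
      (∀ qStar : κ → Γ.Dom p, (∀ j, f (qStar j) = q j) → DefinesComposite Δ Γ θB g f qStar)

/-! ### Triangular groups -/

/-- `T_n(F)`: the group of invertible upper triangular matrices. -/
def T (n : ℕ) (F : Type*) [Field F] : Subgroup (GL (Fin n) F) where
  carrier := {g | (g : Matrix (Fin n) (Fin n) F).BlockTriangular id}
  mul_mem' := by
    intro a b ha hb
    have := Matrix.BlockTriangular.mul (M := (a : Matrix (Fin n) (Fin n) F)) ha hb
    simpa using this
  one_mem' := by
    simpa using Matrix.blockTriangular_one
  inv_mem' := by
    intro a ha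
    have := Matrix.blockTriangular_inv_of_blockTriangular
      (M := (a : Matrix (Fin n) (Fin n) F)) ha
    simpa using this

/-- The `(i, j)` entry of an element of `T_n(F)`. -/
def entry {n : ℕ} {F : Type*} [Field F] (g : T n F) (i j : Fin n) : F :=
  (g.1 : Matrix (Fin n) (Fin n) F) i j

theorem entry_mul_diag {n : ℕ} {F : Type*} [Field F] (g h : T n F) (i : Fin n) :
    entry (g * h) i i = entry g i i * entry h i i := by
  have hg : (g.1 : Matrix (Fin n) (Fin n) F).BlockTriangular id := g.2
  have hh : (h.1 : Matrix (Fin n) (Fin n) F).BlockTriangular id := h.2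
  simp only [entry, Subgroup.coe_mul, Units.val_mul, Matrix.mul_apply]
  rw [Finset.sum_eq_single i]
  · intro j _ hj
    rcases lt_or_gt_of_ne hj with hlt | hlt
    · rw [hg (show id j < id i from hlt), zero_mul]
    · rw [hh (show id i < id j from hlt), mul_zero]
  · simp

/-- The homomorphism that sends an upper triangular matrix to its diagonal. -/
def diagPart (n : ℕ) (F : Type*) [Field F] : T n F →* (Fin n → F) where
  toFun g i := entry g i i
  map_one' := by
    funext i
    simp [entry]
  map_mul' g h := by
    funext i
    exact entry_mul_diag g h i

/-- `UT_n(F)`: the (normal) subgroup of unitriangular matrices, those with diagonal `1`. -/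
def UT (n : ℕ) (F : Type*) [Field F] : Subgroup (T n F) := (diagPart n F).ker

instance (n : ℕ) (F : Type*) [Field F] : (UT n F).Normal :=
  inferInstanceAs ((diagPart n F).ker).Normal

/-- An upper triangular matrix with non-zero diagonal entries, as an element of `T_n(F)`. -/
noncomputable def ofMatrix {n : ℕ} {F : Type*} [Field F] (M : Matrix (Fin n) (Fin n) F)
    (hM : M.BlockTriangular id) (hd : ∀ i, M i i ≠ 0) : T n F :=
  ⟨Matrix.GeneralLinearGroup.mkOfDetNeZero M (by
    rw [Matrix.det_of_isUpperTriangular hM]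
    exact Finset.prod_ne_zero_iff.mpr fun i _ => hd i), hM⟩

/-- The transvection `t_{ij} = t_{ij}(1) = I + E_{ij}`, `i < j`. -/
noncomputable def t {n : ℕ} {F : Type*} [Field F] (i j : Fin n) (hij : i < j) : T n F :=
  ofMatrix (Matrix.transvection i j (1 : F))
    (by
      intro a b hab
      have hba : b < a := hab
      have h1 : ¬ (i = a ∧ j = b) := by
        rintro ⟨rfl, rfl⟩
        exact absurd hij (not_lt.mpr hba.le)
      simp [Matrix.transvection, Matrix.one_apply_ne hba.ne', h1])
    (by
      intro a
      have h1 : ¬ (i = a ∧ j = a) := by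
        rintro ⟨rfl, rfl⟩
        exact lt_irrefl _ hij
      simp [Matrix.transvection, h1])

/-- The diagonal matrix `diag(α_1, …, α_n)`. -/
noncomputable def diag {n : ℕ} {F : Type*} [Field F] (α : Fin n → Fˣ) : T n F :=
  ofMatrix (Matrix.diagonal fun i => (α i : F)) (Matrix.blockTriangular_diagonal _)
    (by simp)

/-- The diagonal matrix `d_i(α)`, with `α` in place `i` and `1` elsewhere on the diagonal. -/
noncomputable def d {n : ℕ} {F : Type*} [Field F] (i : Fin n) (α : Fˣ) : T n F :=
  diag (Pi.mulSingle i α)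

/-- `B_n(F)`, the product of the subgroups `d_i(Fˣ)` over all indices `i` but the last one. -/
def B (n : ℕ) (F : Type*) [Field F] : Subgroup (T n F) :=
  Subgroup.closure {g | ∃ (i : Fin n) (α : Fˣ), (i : ℕ) + 1 < n ∧ g = d i α}

/-- `PT_n(F) = T_n(F) / Z(T_n(F))`. -/
abbrev PT (n : ℕ) (F : Type*) [Field F] : Type _ := T n F ⧸ Subgroup.center (T n F)

/-- Index set of the parameters: pairs `i < j` for the transvections, and `i` for `d_i`. -/
abbrev ParamIndex (n : ℕ) : Type := {ij : Fin n × Fin n // ij.1 < ij.2} ⊕ Fin n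

/-- The images in `PT_n(F)` of the transvections `t_{ij}`, `i < j`, and of `d_i = d_i(-1)`. -/
noncomputable def params (n : ℕ) (F : Type*) [Field F] : ParamIndex n → PT n F :=
  Sum.elim (fun ij => QuotientGroup.mk (t ij.1.1 ij.1.2 ij.2)) (fun i => QuotientGroup.mk (d i (-1)))

end TriBi

namespace TriBi


/-! ### Definability without parameters, for predicates and functions of finitely many variables -/

section Definability

variable {L : FirstOrder.Language.{0, 0}} {M : Type*} [L.Structure M] {α β : Type}

/-! Call the image in $PT_n(F)$ of the matrices $I+aE_{1n}$ the corner subgroup. It is a copy of the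
additive group of $F$ and consists exactly of the elements that commute with all commutators
(`centralizesComm_iff`), so it is definable without parameters. Conjugation by a triangular $M$
multiplies $a$ by $M_{11}/M_{nn}$, and every non-zero factor occurs. Once a non-trivial corner
element $u$ is named as the unit, "$z$ is the product of $x\ne 0$ and $y$" says that some $g$
conjugates $u$ to $x$ and $y$ to $z$ (`fieldMul_corner`). This interprets $F$ in $G$; conversely $G$
is the group of triangular matrices over $F$ modulo scalars.

To link the two interpretations, the entries of a matrix are read off inside the group. For the
standard parameters, conjugating $t_{in}$ by $M$, or taking the commutator of $M$ with $d_n$ when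
$i=n$, writes column $i$ of $M$, divided by $M_{nn}$, into the last column. A commutator with
$t_{1k}$, or with $d_1$ when $k=1$, then moves its $k$-th entry into the corner (`entryElt_params`).
The reflections cost factors 2, which are invertible. Hence "$y$ is the class of the matrix $x$"
becomes a group formula, `Represents`.

The formula for admissible parameters, `GoodParams`, does not describe the shape of the parameters.
It states that `Represents p` is an isomorphism from the triangular group over the interpreted
field, modulo scalars, onto $G$, and that it takes the transvection with corner entry $z$ to $z$
itself. Every good $p$ thus gives an automorphism $e$ of $G$ with
$e(\mathrm{corner}\,a)=\mathrm{corner}(ua)$ (`GoodParams.exists_mulEquiv`). The last property lets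
one pair of coordinate maps have both composites definable. Arbitrary coordinate maps differ from
the standard ones by an isomorphism and are handled by transport. -/

/-- The predicate `P` of an assignment of the variables `α` is defined by a formula of `L`. -/
def DefPred (L : FirstOrder.Language.{0, 0}) {M : Type*} [L.Structure M] {α : Type}
    (P : (α → M) → Prop) : Prop :=
  ∃ φ : L.Formula α, ∀ v : α → M, φ.Realize v ↔ P v

/-- The function `f` of an assignment of the variables `α` is given by a term of `L`. -/
def DefTerm (L : FirstOrder.Language.{0, 0}) {M : Type*} [L.Structure M] {α : Type}
    (f : (α → M) → M) : Prop :=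
  ∃ s : L.Term α, ∀ v : α → M, s.realize v = f v

theorem DefTerm.var (a : α) : DefTerm L (fun v : α → M => v a) :=
  ⟨FirstOrder.Language.Term.var a, fun _ => rfl⟩

theorem DefPred.congr {P Q : (α → M) → Prop} (h : DefPred L P) (hPQ : ∀ v, P v ↔ Q v) :
    DefPred L Q :=
  let ⟨φ, hφ⟩ := h
  ⟨φ, fun v => (hφ v).trans (hPQ v)⟩

theorem DefPred.eq {f g : (α → M) → M} (hf : DefTerm L f) (hg : DefTerm L g) :
    DefPred L (fun v => f v = g v) := by
  obtain ⟨s, hs⟩ := hf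
  obtain ⟨s', hs'⟩ := hg
  exact ⟨s.equal s', fun v => by rw [FirstOrder.Language.Formula.realize_equal, hs, hs']⟩

theorem DefPred.not {P : (α → M) → Prop} (hP : DefPred L P) : DefPred L (fun v => ¬ P v) := by
  obtain ⟨φ, hφ⟩ := hP
  exact ⟨φ.not, fun v => by rw [FirstOrder.Language.Formula.realize_not, hφ]⟩

theorem DefPred.ne {f g : (α → M) → M} (hf : DefTerm L f) (hg : DefTerm L g) :
    DefPred L (fun v => f v ≠ g v) := (DefPred.eq hf hg).not

theorem DefPred.and {P Q : (α → M) → Prop} (hP : DefPred L P) (hQ : DefPred L Q) :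
    DefPred L (fun v => P v ∧ Q v) := by
  obtain ⟨φ, hφ⟩ := hP
  obtain ⟨χ, hχ⟩ := hQ
  exact ⟨φ ⊓ χ, fun v => by rw [FirstOrder.Language.Formula.realize_inf, hφ, hχ]⟩

theorem DefPred.or {P Q : (α → M) → Prop} (hP : DefPred L P) (hQ : DefPred L Q) :
    DefPred L (fun v => P v ∨ Q v) := by
  obtain ⟨φ, hφ⟩ := hP
  obtain ⟨χ, hχ⟩ := hQ
  exact ⟨φ ⊔ χ, fun v => by rw [FirstOrder.Language.Formula.realize_sup, hφ, hχ]⟩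

theorem DefPred.imp {P Q : (α → M) → Prop} (hP : DefPred L P) (hQ : DefPred L Q) :
    DefPred L (fun v => P v → Q v) := by
  obtain ⟨φ, hφ⟩ := hP
  obtain ⟨χ, hχ⟩ := hQ
  exact ⟨φ.imp χ, fun v => by rw [FirstOrder.Language.Formula.realize_imp, hφ, hχ]⟩

theorem DefPred.true : DefPred L (fun _ : α → M => True) :=
  ⟨⊤, fun _ => by simp⟩

/-- A conjunction indexed by a finite type. -/
theorem DefPred.conj {κ : Type*} [Finite κ] {P : κ → (α → M) → Prop}
    (h : ∀ k, DefPred L (P k)) : DefPred L (fun v => ∀ k, P k v) := by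
  choose φ hφ using h
  exact ⟨FirstOrder.Language.Formula.iInf φ, fun v => by simp [hφ]⟩

/-- A hypothesis that does not depend on the assignment. -/
theorem DefPred.ofImp {c : Prop} {P : (α → M) → Prop} (h : c → DefPred L P) :
    DefPred L (fun v => c → P v) := by
  by_cases hc : c
  · exact (h hc).congr fun v => by simp [hc]
  · exact DefPred.true.congr fun v => by simp [hc]

theorem DefPred.existsTuple [Finite β] {P : (α → M) → (β → M) → Prop}
    (h : DefPred L (fun w : α ⊕ β → M => P (fun a => w (Sum.inl a)) (fun b => w (Sum.inr b)))) :
    DefPred L (fun v => ∃ x : β → M, P v x) := by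
  obtain ⟨φ, hφ⟩ := h
  exact ⟨φ.iExs β, fun v => by simp [FirstOrder.Language.Formula.realize_iExs, hφ]⟩

theorem DefPred.forallTuple [Finite β] {P : (α → M) → (β → M) → Prop}
    (h : DefPred L (fun w : α ⊕ β → M => P (fun a => w (Sum.inl a)) (fun b => w (Sum.inr b)))) :
    DefPred L (fun v => ∀ x : β → M, P v x) := by
  obtain ⟨φ, hφ⟩ := h
  exact ⟨φ.iAlls β, fun v => by simp [FirstOrder.Language.Formula.realize_iAlls, hφ]⟩

theorem DefPred.exists {P : (α → M) → M → Prop}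
    (h : DefPred L (fun w : α ⊕ Unit → M => P (fun a => w (Sum.inl a)) (w (Sum.inr ())))) :
    DefPred L (fun v => ∃ x : M, P v x) :=
  (DefPred.existsTuple (β := Unit) (P := fun v x => P v (x ())) h).congr fun _ =>
    ⟨fun ⟨x, hx⟩ => ⟨x (), hx⟩, fun ⟨x, hx⟩ => ⟨fun _ => x, hx⟩⟩

theorem DefPred.forall {P : (α → M) → M → Prop}
    (h : DefPred L (fun w : α ⊕ Unit → M => P (fun a => w (Sum.inl a)) (w (Sum.inr ())))) :
    DefPred L (fun v => ∀ x : M, P v x) :=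
  (DefPred.forallTuple (β := Unit) (P := fun v x => P v (x ())) h).congr fun _ =>
    ⟨fun h x => h fun _ => x, fun h x => h (x ())⟩

/-- Substitution of terms for the variables. -/
theorem DefPred.subst {P : (β → M) → Prop} (hP : DefPred L P) {f : β → (α → M) → M}
    (hf : ∀ b, DefTerm L (f b)) : DefPred L (fun v => P (fun b => f b v)) := by
  obtain ⟨φ, hφ⟩ := hP
  choose s hs using hf
  refine ⟨FirstOrder.Language.BoundedFormula.subst φ s, fun v => ?_⟩
  refine Iff.trans ?_ (hφ fun b => f b v)
  rw [FirstOrder.Language.Formula.Realize, FirstOrder.Language.BoundedFormula.realize_subst,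
    FirstOrder.Language.Formula.Realize]
  simp [hs]

/-! ### Terms of the language of groups. -/

variable {G : Type*} [Group G]

/-- The commutator of two elements of a group. -/
def gcomm (x y : G) : G := x * y * x⁻¹ * y⁻¹

theorem DefTerm.gmul {f g : (α → G) → G} (hf : DefTerm groupLang f) (hg : DefTerm groupLang g) :
    DefTerm groupLang (fun v => f v * g v) := by
  obtain ⟨s, hs⟩ := hf
  obtain ⟨s', hs'⟩ := hg
  refine ⟨FirstOrder.Language.Functions.apply₂ (L := groupLang) GroupFunc.mul s s', fun v => ?_⟩
  change s.realize v * s'.realize v = _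
  rw [hs, hs']

theorem DefTerm.ginv {f : (α → G) → G} (hf : DefTerm groupLang f) :
    DefTerm groupLang (fun v => (f v)⁻¹) := by
  obtain ⟨s, hs⟩ := hf
  refine ⟨FirstOrder.Language.Functions.apply₁ (L := groupLang) GroupFunc.inv s, fun v => ?_⟩
  change (s.realize v)⁻¹ = _
  rw [hs]

theorem DefTerm.gone : DefTerm groupLang (fun _ : α → G => 1) :=
  ⟨FirstOrder.Language.Term.func (L := groupLang) GroupFunc.one ![], fun _ => rfl⟩

theorem DefTerm.gpow {f : (α → G) → G} (hf : DefTerm groupLang f) (k : ℕ) :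
    DefTerm groupLang (fun v => f v ^ k) := by
  induction k with
  | zero => simpa using DefTerm.gone
  | succ k ih => simpa [pow_succ] using ih.gmul hf

theorem DefTerm.gcomm {f g : (α → G) → G} (hf : DefTerm groupLang f)
    (hg : DefTerm groupLang g) : DefTerm groupLang (fun v => gcomm (f v) (g v)) := by
  exact ((hf.gmul hg).gmul hf.ginv).gmul hg.ginv

theorem DefTerm.glistProd {κ : Type*} {f : κ → (α → G) → G} (hf : ∀ k, DefTerm groupLang (f k))
    (l : List κ) : DefTerm groupLang (fun v => (l.map fun k => f k v).prod) := by
  induction l with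
  | nil => simpa using DefTerm.gone
  | cons k l ih => simpa using (hf k).gmul ih

/-! ### Terms of the language of rings. -/

variable {R : Type*} [Field R]

theorem DefTerm.radd {f g : (α → R) → R} (hf : DefTerm FirstOrder.Language.ring f)
    (hg : DefTerm FirstOrder.Language.ring g) : DefTerm FirstOrder.Language.ring (fun v => f v + g v) := by
  obtain ⟨s, hs⟩ := hf
  obtain ⟨s', hs'⟩ := hg
  exact ⟨s + s', fun v => by simp [hs, hs']⟩

theorem DefTerm.rmul {f g : (α → R) → R} (hf : DefTerm FirstOrder.Language.ring f)
    (hg : DefTerm FirstOrder.Language.ring g) : DefTerm FirstOrder.Language.ring (fun v => f v * g v) := by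
  obtain ⟨s, hs⟩ := hf
  obtain ⟨s', hs'⟩ := hg
  exact ⟨s * s', fun v => by simp [hs, hs']⟩

theorem DefTerm.rzero : DefTerm FirstOrder.Language.ring (fun _ : α → R => 0) :=
  ⟨0, fun v => by simp⟩

theorem DefTerm.rone : DefTerm FirstOrder.Language.ring (fun _ : α → R => 1) :=
  ⟨1, fun v => by simp⟩

theorem DefTerm.rlistSum {κ : Type*} {f : κ → (α → R) → R}
    (hf : ∀ k, DefTerm FirstOrder.Language.ring (f k)) (l : List κ) :
    DefTerm FirstOrder.Language.ring (fun v => (l.map fun k => f k v).sum) := by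
  induction l with
  | nil => simpa using DefTerm.rzero
  | cons k l ih => simpa using (hf k).radd ih

theorem DefTerm.rsum {n : ℕ} {f : Fin n → (α → R) → R}
    (hf : ∀ k, DefTerm FirstOrder.Language.ring (f k)) :
    DefTerm FirstOrder.Language.ring (fun v => ∑ k, f k v) := by
  simpa [Fin.sum_univ_def] using DefTerm.rlistSum hf (List.finRange n)

end Definability

/-! ### Uniqueness of coordinate maps up to isomorphism -/

/-- Two coordinate maps of the same interpreted structure differ by an isomorphism. -/
theorem InterpCode.IsCoordinateMap.exists_equiv {L K : FirstOrder.Language.{0, 0}} {ι : Type}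
    {Γ : InterpCode L K ι} {A A' B : Type*} [L.Structure A] [L.Structure A'] [K.Structure B]
    {p : ι → B} {μ : Γ.Dom p → A} {ν : Γ.Dom p → A'}
    (hμ : Γ.IsCoordinateMap p μ) (hν : Γ.IsCoordinateMap p ν) :
    ∃ e : L.Equiv A A', ∀ x, ν x = e (μ x) := by
  -- Both kernels are the relation defined by `Γ.eqv`, so `ν` factors through `μ`; the isomorphism
  -- is `ν` after any section of `μ`.
  have key : ∀ x y, μ x = μ y ↔ ν x = ν y := fun x y =>
    (hμ.eqv_iff x y).symm.trans (hν.eqv_iff x y)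
  let s := Function.surjInv hμ.surjective
  have hs : ∀ a, μ (s a) = a := Function.surjInv_eq hμ.surjective
  have hνs : ∀ x, ν (s (μ x)) = ν x := fun x => (key _ _).1 (hs _)
  have hbij : Function.Bijective (fun a => ν (s a)) := by
    constructor
    · intro a b h
      have := (key _ _).2 h
      rwa [hs, hs] at this
    · intro b
      obtain ⟨x, rfl⟩ := hν.surjective b
      exact ⟨μ x, hνs x⟩
  refine ⟨⟨Equiv.ofBijective _ hbij, ?_, ?_⟩, fun x => (hνs x).symm⟩
  · intro m f xs
    change ν (s (FirstOrder.Language.Structure.funMap f xs)) =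
      FirstOrder.Language.Structure.funMap f (fun k => ν (s (xs k)))
    exact ((hν.fn_iff f (fun k => s (xs k)) _).1 ((hμ.fn_iff f (fun k => s (xs k)) _).2
      (by simp only [hs]))).symm
  · intro m r xs
    change FirstOrder.Language.Structure.RelMap r (fun k => ν (s (xs k))) ↔ _
    exact ((hν.rel_iff r fun k => s (xs k)).symm.trans (hμ.rel_iff r fun k => s (xs k))).trans
      (by simp only [hs])

/-- An isomorphism in the language of groups is a group isomorphism. -/
def mulEquivOfEquiv {G H : Type*} [Group G] [Group H] (e : groupLang.Equiv G H) : G ≃* H :=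
  { e.toEquiv with
    map_mul' := fun x y =>
      e.map_fun (GroupFunc.mul : groupLang.Functions 2) ![x, y] }

/-- A group isomorphism is an isomorphism in the language of groups. -/
def equivOfMulEquiv {G H : Type*} [Group G] [Group H] (e : G ≃* H) : groupLang.Equiv G H :=
  { e.toEquiv with
    map_fun' := fun {m} f x => by
      cases f
      · exact map_mul e _ _
      · exact map_inv e _
      · exact map_one e
    map_rel' := fun {m} r => nomatch r }

/-! ### Calculations in the triangular group -/

section Triangular

variable {n : ℕ} {F : Type*} [Field F]

theorem T_ext {g h : T n F} (H : ∀ i j, entry g i j = entry h i j) : g = h :=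
  Subtype.ext (Units.ext (Matrix.ext H))

theorem entry_mul (g h : T n F) (i j : Fin n) :
    entry (g * h) i j = ∑ k, entry g i k * entry h k j := by
  simp [entry, Matrix.mul_apply]

theorem entry_one (i j : Fin n) : entry (1 : T n F) i j = if i = j then 1 else 0 := by
  simp [entry, Matrix.one_apply]

theorem entry_lower (g : T n F) {i j : Fin n} (h : j < i) : entry g i j = 0 := g.2 h

theorem entry_diag_ne_zero (g : T n F) (i : Fin n) : entry g i i ≠ 0 := by
  intro h
  have := entry_mul_diag g g⁻¹ i
  rw [mul_inv_cancel, h, zero_mul, entry_one, if_pos rfl] at this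
  exact one_ne_zero this

@[simp]
theorem entry_ofMatrix (M : Matrix (Fin n) (Fin n) F) (hM : M.BlockTriangular id)
    (hd : ∀ i, M i i ≠ 0) (i j : Fin n) : entry (ofMatrix M hM hd) i j = M i j := rfl

/-- The transvection `I + a E_{ij}`, `i < j`. -/
noncomputable def tv (i j : Fin n) (hij : i < j) (a : F) : T n F :=
  ofMatrix (Matrix.transvection i j a)
    (by
      intro k l hkl
      have hlk : l < k := hkl
      have h1 : ¬ (i = k ∧ j = l) := by
        rintro ⟨rfl, rfl⟩
        exact absurd hij (not_lt.mpr hlk.le)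
      simp [Matrix.transvection, Matrix.one_apply_ne hlk.ne', h1])
    (by
      intro k
      have h1 : ¬ (i = k ∧ j = k) := by
        rintro ⟨rfl, rfl⟩
        exact lt_irrefl _ hij
      simp [Matrix.transvection, h1])

theorem t_eq_tv (i j : Fin n) (hij : i < j) : (t i j hij : T n F) = tv i j hij 1 := rfl

theorem entry_tv (i j : Fin n) (hij : i < j) (a : F) (k l : Fin n) :
    entry (tv i j hij a) k l = (if k = l then 1 else 0) + if i = k ∧ j = l then a else 0 := by
  simp [tv, Matrix.transvection, Matrix.one_apply, Matrix.single_apply]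

theorem entry_mul_tv (M : T n F) (i j : Fin n) (hij : i < j) (a : F) (k l : Fin n) :
    entry (M * tv i j hij a) k l = entry M k l + if l = j then entry M k i * a else 0 := by
  simp only [entry_mul, entry_tv, mul_add, Finset.sum_add_distrib, ite_and]
  congr 1
  · simp
  · simp [eq_comm]

theorem entry_tv_mul (M : T n F) (i j : Fin n) (hij : i < j) (a : F) (k l : Fin n) :
    entry (tv i j hij a * M) k l = entry M k l + if k = i then a * entry M j l else 0 := by
  simp only [entry_mul, entry_tv, add_mul, Finset.sum_add_distrib, ite_and]
  congr 1
  · simp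
  · by_cases h : k = i
    · simp [h]
    · simp [h, Ne.symm h]

theorem entry_diag (α : Fin n → Fˣ) (k l : Fin n) :
    entry (diag α) k l = if k = l then (α k : F) else 0 := by
  simp [diag, Matrix.diagonal_apply]

theorem entry_mul_diag' (M : T n F) (α : Fin n → Fˣ) (k l : Fin n) :
    entry (M * diag α) k l = entry M k l * α l := by
  simp [entry_mul, entry_diag]

theorem entry_diag_mul (M : T n F) (α : Fin n → Fˣ) (k l : Fin n) :
    entry (diag α * M) k l = α k * entry M k l := by
  simp [entry_mul, entry_diag]

theorem entry_mul_d (M : T n F) (i : Fin n) (α : Fˣ) (k l : Fin n) :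
    entry (M * d i α) k l = entry M k l * if l = i then (α : F) else 1 := by
  rw [d, entry_mul_diag', Pi.mulSingle_apply]
  split_ifs <;> simp

theorem entry_d_mul (M : T n F) (i : Fin n) (α : Fˣ) (k l : Fin n) :
    entry (d i α * M) k l = (if k = i then (α : F) else 1) * entry M k l := by
  rw [d, entry_diag_mul, Pi.mulSingle_apply]
  split_ifs <;> simp

theorem tv_mul_tv (i j : Fin n) (hij : i < j) (a b : F) :
    tv i j hij a * tv i j hij b = tv i j hij (a + b) := by
  refine T_ext fun k l => ?_
  rw [entry_mul_tv]
  simp only [entry_tv, hij.ne', and_false, if_false, add_zero]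
  rcases eq_or_ne i k with rfl | hk
  · rcases eq_or_ne j l with rfl | hl
    · simp [hij.ne]
    · simp [hl, hl.symm]
  · simp [hk, hk.symm]

theorem tv_zero (i j : Fin n) (hij : i < j) : tv i j hij (0 : F) = 1 := by
  refine T_ext fun k l => ?_
  rw [entry_tv, entry_one]
  simp

theorem tv_inv (i j : Fin n) (hij : i < j) (a : F) :
    (tv i j hij a)⁻¹ = tv i j hij (-a) := by
  rw [inv_eq_iff_mul_eq_one, tv_mul_tv, add_neg_cancel, tv_zero]

/-- The homomorphism that sends a tuple of units to the diagonal matrix. -/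
noncomputable def diagHom (n : ℕ) (F : Type*) [Field F] : (Fin n → Fˣ) →* T n F where
  toFun := diag
  map_one' := T_ext fun i j => by simp [entry_diag, entry_one]
  map_mul' α β := T_ext fun i j => by
    rw [entry_mul_diag', entry_diag, entry_diag]
    split_ifs with h <;> simp [h]

theorem diag_scalar_mem_center (s : Fˣ) :
    (diag (fun _ => s) : T n F) ∈ Subgroup.center (T n F) := by
  rw [Subgroup.mem_center_iff]
  intro g
  refine T_ext fun i j => ?_
  rw [entry_mul_diag', entry_diag_mul, mul_comm]

/-- The shape of a matrix that commutes with a transvection. -/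
theorem entry_of_commute_t {M : T n F} {i j : Fin n} {hij : i < j}
    (h : M * t i j hij = t i j hij * M) (k l : Fin n) :
    (if l = j then entry M k i else 0) = if k = i then entry M j l else 0 := by
  have := congrArg (fun g => entry g k l) h
  simpa only [t_eq_tv, entry_mul_tv, entry_tv_mul, mul_one, one_mul, add_right_inj] using this

theorem UT_entry {u : T n F} (hu : u ∈ UT n F) (i : Fin n) : entry u i i = 1 :=
  congrFun (MonoidHom.mem_ker.1 hu) i

/-- The diagonal is multiplicative with commutative values. Its target is only a monoid, so the
inverses are cancelled by hand. -/
theorem gcomm_mem_UT (g h : T n F) : gcomm g h ∈ UT n F := by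
  rw [UT, MonoidHom.mem_ker]
  simp only [gcomm]
  have hg : diagPart n F g * diagPart n F g⁻¹ = 1 := by rw [← map_mul, mul_inv_cancel, map_one]
  have hh : diagPart n F h * diagPart n F h⁻¹ = 1 := by rw [← map_mul, mul_inv_cancel, map_one]
  rw [map_mul, map_mul, map_mul, mul_right_comm (diagPart n F g), hg, one_mul, hh]

end Triangular

/-! ### The corner subgroup, the action of the group on it, and its definition as the centraliser of
all commutators. -/

section Corner

variable {m : ℕ} {F : Type*} [Field F]

theorem zero_lt_last' : (0 : Fin (m + 2)) < Fin.last (m + 1) := Fin.last_pos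

/-- Commuting with $t_{0i}$ equates two diagonal entries and kills the rest of row $i$; commuting
with $t_{j,\mathrm{last}}$ kills the rest of column $j$. Only the corner entry escapes both. -/
theorem commute_all_t {M : T (m + 2) F}
    (h : ∀ (i j : Fin (m + 2)) (hij : i < j), M * t i j hij = t i j hij * M) :
    (∀ i, entry M i i = entry M 0 0) ∧
      ∀ i j, i ≠ j → ¬ (i = 0 ∧ j = Fin.last (m + 1)) → entry M i j = 0 := by
  constructor
  · intro i
    by_cases hi : i = 0
    · rw [hi]
    · have := entry_of_commute_t (h 0 i (Fin.pos_iff_ne_zero.2 hi)) 0 i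
      simpa using this.symm
  · intro i j hij hc
    by_cases hj : j = Fin.last (m + 1)
    · have hi : i ≠ 0 := fun h => hc ⟨h, hj⟩
      have := entry_of_commute_t (h 0 i (Fin.pos_iff_ne_zero.2 hi)) 0 j
      simpa [hij.symm] using this.symm
    · have hl : j < Fin.last (m + 1) := Fin.lt_last_iff_ne_last.2 hj
      have := entry_of_commute_t (h j _ hl) i (Fin.last (m + 1))
      simpa [hij] using this

/-- Commuting with the transvections leaves a scalar matrix plus a corner entry; commuting with
$d_0(-1)$ makes that entry equal to its negative, hence zero. -/
theorem mem_center_iff_scalar (h2 : (2 : F) ≠ 0) {M : T (m + 2) F} :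
    M ∈ Subgroup.center (T (m + 2) F) ↔
      ∀ i j, entry M i j = if i = j then entry M 0 0 else 0 := by
  constructor
  · intro hM
    rw [Subgroup.mem_center_iff] at hM
    obtain ⟨hd, ho⟩ := commute_all_t (M := M) fun i j hij => (hM _).symm
    intro i j
    split_ifs with hij
    · rw [← hij, hd]
    · by_cases hc : i = 0 ∧ j = Fin.last (m + 1)
      · have := congrArg (fun g => entry g i j) (hM (d 0 (-1)))
        simp only [entry_mul_d, entry_d_mul, hc.1, hc.2, if_true, zero_lt_last'.ne', if_false,
          mul_one, Units.val_neg, Units.val_one] at this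
        rw [hc.1, hc.2]
        have h3 : 2 * entry M 0 (Fin.last (m + 1)) = 0 := by linear_combination -this
        exact (mul_eq_zero.1 h3).resolve_left h2
      · exact ho i j hij hc
  · intro h
    have : M = diag fun _ => Units.mk0 _ (entry_diag_ne_zero M 0) :=
      T_ext fun i j => by rw [h, entry_diag]; rfl
    rw [this]
    exact diag_scalar_mem_center _

/-- The centre is the group of scalars, so equality in the quotient is proportionality of entries.
All later computations in `PT` go through this. -/
theorem mk_eq_mk_iff (h2 : (2 : F) ≠ 0) {M N : T (m + 2) F} :
    (QuotientGroup.mk M : PT (m + 2) F) = QuotientGroup.mk N ↔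
      ∃ s : F, s ≠ 0 ∧ ∀ i j, entry N i j = s * entry M i j := by
  rw [QuotientGroup.eq]
  constructor
  · intro h
    have hz := (mem_center_iff_scalar h2).1 h
    refine ⟨_, entry_diag_ne_zero (M⁻¹ * N) 0, fun i j => ?_⟩
    have : N = M * (M⁻¹ * N) := by group
    conv_lhs => rw [this, entry_mul]
    rw [Finset.sum_congr rfl fun k _ => by rw [hz k j]]
    simp [mul_comm]
  · rintro ⟨s, hs, h⟩
    have : N = M * diag fun _ => Units.mk0 s hs :=
      T_ext fun i j => by rw [entry_mul_diag', h, mul_comm]; rfl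
    rw [this, inv_mul_cancel_left]
    exact diag_scalar_mem_center _

/-- The class of the transvection `I + a E_{1n}`. -/
noncomputable def corner (a : F) : PT (m + 2) F :=
  QuotientGroup.mk (tv 0 (Fin.last (m + 1)) zero_lt_last' a)

theorem corner_add (a b : F) : (corner (a + b) : PT (m + 2) F) = corner a * corner b := by
  rw [corner, ← tv_mul_tv]
  rfl

theorem corner_zero : (corner 0 : PT (m + 2) F) = 1 := by
  rw [corner, tv_zero]
  rfl

theorem corner_inv (a : F) : (corner a : PT (m + 2) F)⁻¹ = corner (-a) := by
  rw [inv_eq_iff_mul_eq_one, ← corner_add, add_neg_cancel, corner_zero]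

theorem corner_pow (a : F) (k : ℕ) : (corner a : PT (m + 2) F) ^ k = corner (k * a) := by
  induction k with
  | zero => simp [corner_zero]
  | succ k ih => rw [pow_succ, ih, ← corner_add]; push_cast; ring_nf

theorem corner_list_sum (l : List F) :
    (corner l.sum : PT (m + 2) F) = (l.map corner).prod := by
  induction l with
  | nil => simp [corner_zero]
  | cons a l ih => simp [corner_add, ih]

theorem mk_eq_corner_iff (h2 : (2 : F) ≠ 0) {M : T (m + 2) F} {a : F} :
    (QuotientGroup.mk M : PT (m + 2) F) = corner a ↔
      (∀ i, entry M i i = entry M 0 0) ∧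
      (∀ i j, i ≠ j → ¬ (i = 0 ∧ j = Fin.last (m + 1)) → entry M i j = 0) ∧
      entry M 0 (Fin.last (m + 1)) = a * entry M 0 0 := by
  rw [eq_comm, corner, mk_eq_mk_iff h2]
  constructor
  · rintro ⟨s, -, h⟩
    refine ⟨fun i => ?_, fun i j hij hc => ?_, ?_⟩
    · rw [h, h, entry_tv, entry_tv]
      have h1 : ∀ k : Fin (m + 2), ¬ (0 = k ∧ Fin.last (m + 1) = k) := by
        rintro k ⟨rfl, h⟩
        exact zero_lt_last'.ne' h
      simp [h1]
    · rw [h, entry_tv, if_neg hij, if_neg fun h => hc ⟨h.1.symm, h.2.symm⟩]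
      simp
    · rw [h, h, entry_tv, entry_tv]
      simp [zero_lt_last'.ne, mul_comm]
  · rintro ⟨h1, h3, h4⟩
    refine ⟨_, entry_diag_ne_zero M 0, fun i j => ?_⟩
    rw [entry_tv]
    by_cases hij : i = j
    · subst hij
      have h5 : ¬ (0 = i ∧ Fin.last (m + 1) = i) := by
        rintro ⟨rfl, h⟩
        exact zero_lt_last'.ne' h
      simp [h5, h1 i]
    · by_cases hc : i = 0 ∧ j = Fin.last (m + 1)
      · rw [hc.1, hc.2, h4]
        simp [zero_lt_last'.ne, mul_comm]
      · rw [h3 i j hij hc, if_neg hij, if_neg fun h => hc ⟨h.1.symm, h.2.symm⟩]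
        simp

theorem corner_injective (h2 : (2 : F) ≠ 0) :
    Function.Injective (corner : F → PT (m + 2) F) := by
  intro a b h
  have := ((mk_eq_corner_iff h2).1 h).2.2
  simpa [entry_tv, zero_lt_last'.ne, zero_lt_last'.ne'] using this

theorem corner_eq_one_iff (h2 : (2 : F) ≠ 0) {a : F} :
    (corner a : PT (m + 2) F) = 1 ↔ a = 0 := by
  rw [← corner_zero, (corner_injective h2).eq_iff]

/-- The factor by which conjugation by a triangular matrix multiplies the corner entry. -/
theorem mk_mul_corner (M : T (m + 2) F) (a : F) :
    (QuotientGroup.mk M : PT (m + 2) F) * corner a =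
      corner (entry M 0 0 / entry M (Fin.last _) (Fin.last _) * a) * QuotientGroup.mk M := by
  refine congrArg QuotientGroup.mk (T_ext fun i j => ?_)
  rw [entry_mul_tv, entry_tv_mul]
  congr 1
  -- Right multiplication adds a multiple of column 0 to the last column, left multiplication a
  -- multiple of the last row to row 0. By triangularity each changes the corner entry only.
  by_cases hi : i = 0
  · by_cases hj : j = Fin.last (m + 1)
    · have := entry_diag_ne_zero M (Fin.last (m + 1))
      simp only [hi, hj, if_true]
      field_simp
    · rw [entry_lower M (Fin.lt_last_iff_ne_last.2 hj)]
      simp [hj]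
  · rw [entry_lower M (Fin.pos_iff_ne_zero.2 hi)]
    simp [hi]

/-- Witnessed by $d_0(s)$. Conjugation is thus transitive on the non-trivial corner elements, which
is what makes multiplication definable. -/
theorem exists_mul_corner (s : F) (hs : s ≠ 0) :
    ∃ g : PT (m + 2) F, ∀ a, g * corner a = corner (s * a) * g := by
  refine ⟨QuotientGroup.mk (d 0 (Units.mk0 s hs)), fun a => ?_⟩
  rw [mk_mul_corner]
  congr 3
  have h1 := entry_mul_d (1 : T (m + 2) F) 0 (Units.mk0 s hs) 0 0
  have h3 := entry_mul_d (1 : T (m + 2) F) 0 (Units.mk0 s hs) (Fin.last _) (Fin.last _)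
  rw [one_mul] at h1 h3
  rw [h1, h3]
  simp [entry_one, zero_lt_last'.ne']

theorem exists_factor (g : PT (m + 2) F) :
    ∃ s : F, s ≠ 0 ∧ ∀ a, g * corner a = corner (s * a) * g := by
  obtain ⟨M, rfl⟩ := QuotientGroup.mk_surjective g
  exact ⟨_, div_ne_zero (entry_diag_ne_zero M _) (entry_diag_ne_zero M _), mk_mul_corner M⟩

/-- An element of a group that commutes with all commutators. -/
def CentralizesComm {G : Type*} [Group G] (x : G) : Prop :=
  ∀ g h : G, x * gcomm g h = gcomm g h * x

theorem CentralizesComm.map {G H : Type*} [Group G] [Group H] (e : G ≃* H) {x : G}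
    (hx : CentralizesComm x) : CentralizesComm (e x) := by
  intro g h
  have := congrArg e (hx (e.symm g) (e.symm h))
  simpa [gcomm] using this

theorem centralizesComm_map_iff {G H : Type*} [Group G] [Group H] (e : G ≃* H) {x : G} :
    CentralizesComm (e x) ↔ CentralizesComm x :=
  ⟨fun h => by simpa using h.map e.symm, fun h => h.map e⟩

/-- Conjugation by $d_i(-1)$ inverts $t_{ij}(a)$, so the commutator is $t_{ij}(-2a)$. Taking
$a=-1/2$ shows that every $t_{ij}$ is a commutator. -/
theorem gcomm_d_tv (h2 : (2 : F) ≠ 0) {n : ℕ} (i j : Fin n) (hij : i < j) :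
    gcomm (d i (-1)) (tv i j hij (-(1 / 2) : F)) = t i j hij := by
  have : d i (-1) * tv i j hij (-(1 / 2) : F) = tv i j hij (1 / 2) * d i (-1) := by
    refine T_ext fun k l => ?_
    rw [entry_mul_tv, entry_mul_d, ← mul_one (d i (-1)), entry_d_mul, entry_d_mul]
    simp only [entry_one, entry_tv]
    by_cases hk : k = i <;> by_cases hl : l = j <;>
      simp [hk, hl, eq_comm, hij.ne] <;> aesop
  rw [gcomm, this, tv_inv, mul_inv_cancel_right, tv_mul_tv, t_eq_tv]
  congr 1
  field_simp
  norm_num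

/-- Every $t_{ij}$ is a commutator, so `commute_all_t` applies to a centralising element. Conversely
commutators are unitriangular, and conjugation by them scales the corner by $1/1$. -/
theorem centralizesComm_iff (h2 : (2 : F) ≠ 0) {x : PT (m + 2) F} :
    CentralizesComm x ↔ ∃ a, x = corner a := by
  constructor
  · intro h
    obtain ⟨M, rfl⟩ := QuotientGroup.mk_surjective x
    have hc : ∀ (i j : Fin (m + 2)) (hij : i < j), M * t i j hij = t i j hij * M := by
      intro i j hij
      have h1 := h (QuotientGroup.mk (d i (-1))) (QuotientGroup.mk (tv i j hij (-(1 / 2))))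
      have h3 : (QuotientGroup.mk (M * gcomm (d i (-1)) (tv i j hij (-(1 / 2)))) :
          PT (m + 2) F) = QuotientGroup.mk (gcomm (d i (-1)) (tv i j hij (-(1 / 2))) * M) := h1
      rw [gcomm_d_tv h2, mk_eq_mk_iff h2] at h3
      obtain ⟨s, -, hs⟩ := h3
      -- In the quotient the matrices commute only up to a scalar $s$; neither product changes the
      -- $(i,i)$ entry of $M$, which forces $s=1$.
      have h4 := hs i i
      simp only [t_eq_tv, entry_mul_tv, entry_tv_mul, hij.ne, if_false, if_true,
        entry_lower M hij] at h4
      have hs1 : s = 1 := by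
        have := entry_diag_ne_zero M i
        apply mul_right_cancel₀ this
        linear_combination -h4
      exact T_ext fun k l => by rw [hs k l, hs1, one_mul]
    obtain ⟨h1, h3⟩ := commute_all_t hc
    refine ⟨entry M 0 (Fin.last _) / entry M 0 0, (mk_eq_corner_iff h2).2 ⟨h1, h3, ?_⟩⟩
    rw [div_mul_cancel₀ _ (entry_diag_ne_zero M 0)]
  · rintro ⟨a, rfl⟩ g h
    obtain ⟨A, rfl⟩ := QuotientGroup.mk_surjective g
    obtain ⟨B, rfl⟩ := QuotientGroup.mk_surjective h
    have h1 := mk_mul_corner (gcomm A B) a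
    rw [UT_entry (gcomm_mem_UT A B), UT_entry (gcomm_mem_UT A B), div_one, one_mul] at h1
    exact h1.symm

end Corner

/-! ### Reading off the entries of a triangular matrix inside the group -/

section Coordinates

variable {m : ℕ} {F : Type*} [Field F]

/-- The unitriangular matrix that differs from `I` in the last column only, where it has the
entries of `v` above the diagonal. -/
noncomputable def lastCol (v : Fin (m + 2) → F) : T (m + 2) F :=
  ofMatrix (1 + Matrix.of fun i j => if j = Fin.last _ ∧ i ≠ Fin.last _ then v i else 0)
    (by
      intro i j hij
      have hji : j < i := hij
      have h1 : j ≠ Fin.last _ := (hji.trans_le (Fin.le_last i)).ne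
      simp [Matrix.one_apply_ne hji.ne', h1])
    (by
      intro i
      have h1 : ¬ (i = Fin.last (m + 1) ∧ i ≠ Fin.last _) := fun h => h.2 h.1
      simp)

theorem entry_lastCol (v : Fin (m + 2) → F) (i j : Fin (m + 2)) :
    entry (lastCol v) i j =
      (if i = j then 1 else 0) + if j = Fin.last _ ∧ i ≠ Fin.last _ then v i else 0 := by
  change (1 : Matrix (Fin (m + 2)) (Fin (m + 2)) F) i j +
    (if j = Fin.last _ ∧ i ≠ Fin.last _ then v i else 0) = _
  rw [Matrix.one_apply]

theorem entry_lastCol_mul (v : Fin (m + 2) → F) (M : T (m + 2) F) (i j : Fin (m + 2)) :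
    entry (lastCol v * M) i j = entry M i j +
      if j = Fin.last _ ∧ i ≠ Fin.last _ then v i * entry M (Fin.last _) (Fin.last _) else 0 := by
  simp only [entry_mul, entry_lastCol, add_mul, Finset.sum_add_distrib, ite_and]
  congr 1
  · simp
  · simp only [ite_mul, zero_mul, Finset.sum_ite_eq', Finset.mem_univ, if_true]
    by_cases hj : j = Fin.last _
    · simp [hj]
    · simp [hj, entry_lower M (Fin.lt_last_iff_ne_last.2 hj)]

/-- $ME_{i,\mathrm{last}}M^{-1}$ is column $i$ of $M$ placed in the last column and divided by the
last diagonal entry, because the last row of $M^{-1}$ has only its diagonal entry. -/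
theorem mul_t_last (M : T (m + 2) F) (i : Fin (m + 2)) (hi : i < Fin.last (m + 1)) :
    M * t i (Fin.last _) hi =
      lastCol (fun k => entry M k i / entry M (Fin.last _) (Fin.last _)) * M := by
  refine T_ext fun k l => ?_
  rw [t_eq_tv, entry_mul_tv, entry_lastCol_mul, div_mul_cancel₀ _ (entry_diag_ne_zero M _)]
  by_cases hk : k = Fin.last _
  · simp [hk, entry_lower M hi]
  · simp [hk]

/-- Replaces conjugation of a transvection for the last column of $M$. The 2 comes from
$d_{\mathrm{last}}(-1)=I-2E_{\mathrm{last},\mathrm{last}}$. -/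
theorem mul_d_last (M : T (m + 2) F) :
    M * d (Fin.last _) (-1) =
      lastCol (fun k => 2 * (entry M k (Fin.last _) / entry M (Fin.last _) (Fin.last _))) *
        (d (Fin.last _) (-1) * M) := by
  refine T_ext fun k l => ?_
  rw [entry_mul_d, entry_lastCol_mul, entry_d_mul, entry_d_mul]
  have := entry_diag_ne_zero M (Fin.last _)
  by_cases hk : k = Fin.last _
  · by_cases hl : l = Fin.last _
    · simp [hk, hl]
    · simp [hk, hl, entry_lower M (Fin.lt_last_iff_ne_last.2 hl)]
  · by_cases hl : l = Fin.last _
    · simp only [hk, hl, if_true, if_false, Units.val_neg, Units.val_one, ne_eq,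
        not_false_eq_true, and_self]
      field_simp
      ring
    · simp [hk, hl]

/-- The commutator with $t_{0k}$ extracts $v_k$ into the corner. -/
theorem t_mul_lastCol (v : Fin (m + 2) → F) (k : Fin (m + 2)) (hk : 0 < k)
    (hkl : k ≠ Fin.last _) :
    t 0 k hk * lastCol v =
      tv 0 (Fin.last _) zero_lt_last' (v k) * (lastCol v * t 0 k hk) := by
  refine T_ext fun i j => ?_
  rw [t_eq_tv, entry_tv_mul, entry_tv_mul, entry_mul_tv, entry_mul_tv]
  simp only [entry_lastCol]
  by_cases hi : i = 0
  · subst hi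
    by_cases hj : j = k
    · subst hj
      simp [hkl, Ne.symm hkl, zero_lt_last'.ne']
    · by_cases hj' : j = Fin.last _
      · subst hj'
        simp [hkl, Ne.symm hkl, zero_lt_last'.ne]
      · simp [hj, hj', Ne.symm hj, Ne.symm hj']
  · simp [hi, zero_lt_last'.ne]

/-- Extracts $v_0$, for which there is no $t_{0k}$: $d_0(-1)$ negates this entry alone, so the
commutator doubles it and cancels the others. -/
theorem lastCol_mul_d (v : Fin (m + 2) → F) :
    lastCol v * d 0 (-1) =
      tv 0 (Fin.last _) zero_lt_last' (2 * v 0) * (d 0 (-1) * lastCol v) := by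
  refine T_ext fun i j => ?_
  rw [entry_mul_d, entry_tv_mul, entry_d_mul, entry_d_mul]
  simp only [entry_lastCol]
  by_cases hi : i = 0
  · subst hi
    by_cases hj : j = 0
    · subst hj
      simp [zero_lt_last'.ne, zero_lt_last'.ne']
    · by_cases hj' : j = Fin.last _
      · subst hj'
        simp [zero_lt_last'.ne, zero_lt_last'.ne']
        ring
      · simp [hj, hj', Ne.symm hj, Ne.symm hj']
  · by_cases hj : j = 0
    · simp [hi, hj, zero_lt_last'.ne]
    · simp [hi, hj]

theorem gcomm_eq_of_mul_eq {G : Type*} [Group G] {x y z : G} (h : x * y = z * (y * x)) :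
    gcomm x y = z := by
  rw [gcomm, h]
  group

theorem conj_eq_of_mul_eq {G : Type*} [Group G] {x y z : G} (h : x * y = z * x) :
    x * y * x⁻¹ = z := by
  rw [h, mul_inv_cancel_right]

/-- A conjugate of a last-column transvection, or a commutator with the last reflection: for
the standard parameters it lies in the group of matrices `lastCol v`, and `v` is determined by
the `i`-th column of the matrix `y`. -/
def colElt {G : Type*} [Group G] (p : ParamIndex (m + 2) → G) (y : G) (i : Fin (m + 2)) : G :=
  if h : i < Fin.last (m + 1) then y * p (Sum.inl ⟨(i, Fin.last _), h⟩) * y⁻¹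
  else gcomm y (p (Sum.inr (Fin.last _)))

/-- A commutator that, for the standard parameters, is in the corner subgroup and determined by
the `(k, i)` entry of the matrix `y`. -/
def entryElt {G : Type*} [Group G] (p : ParamIndex (m + 2) → G) (y : G) (k i : Fin (m + 2)) : G :=
  if h : 0 < k then gcomm (p (Sum.inl ⟨(0, k), h⟩)) (colElt p y i)
  else gcomm (colElt p y i) (p (Sum.inr 0))

/-- The factor with which `entryElt` sees the `(k, i)` entry. -/
def entryFactor (k i : Fin (m + 2)) : ℕ :=
  (if 0 < k then 1 else 2) * (if i < Fin.last (m + 1) then 1 else 2)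

theorem entryFactor_ne_zero (h2 : (2 : F) ≠ 0) (k i : Fin (m + 2)) :
    (entryFactor k i : F) ≠ 0 := by
  have h4 : (4 : F) ≠ 0 := by
    rw [show (4 : F) = 2 * 2 by norm_num]
    exact mul_ne_zero h2 h2
  unfold entryFactor
  split_ifs <;> simp [h2, h4]

theorem colElt_params (M : T (m + 2) F) (i : Fin (m + 2)) :
    colElt (params (m + 2) F) (QuotientGroup.mk M) i =
      QuotientGroup.mk (lastCol fun k => (if i < Fin.last (m + 1) then 1 else 2) *
        (entry M k i / entry M (Fin.last _) (Fin.last _))) := by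
  unfold colElt
  split_ifs with h
  · simp only [one_mul]
    exact conj_eq_of_mul_eq (congrArg QuotientGroup.mk (mul_t_last M i h))
  · obtain rfl : i = Fin.last _ := not_not.1 fun h' => h (Fin.lt_last_iff_ne_last.2 h')
    exact gcomm_eq_of_mul_eq (congrArg QuotientGroup.mk (mul_d_last M))

/-- The row `k = Fin.last _` is excluded because `lastCol` records only entries above the diagonal.
Of that row only the diagonal entry is non-zero, and it is the normalising denominator. -/
theorem entryElt_params (M : T (m + 2) F) (k i : Fin (m + 2)) (hk : k ≠ Fin.last _) :
    entryElt (params (m + 2) F) (QuotientGroup.mk M) k i =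
      corner (entryFactor k i * (entry M k i / entry M (Fin.last _) (Fin.last _))) := by
  unfold entryElt entryFactor
  rw [colElt_params]
  split_ifs with h h' h'
  · refine gcomm_eq_of_mul_eq ((congrArg QuotientGroup.mk (t_mul_lastCol _ k h hk)).trans ?_)
    simp [corner, params]
  · refine gcomm_eq_of_mul_eq ((congrArg QuotientGroup.mk (t_mul_lastCol _ k h hk)).trans ?_)
    simp [corner, params]
  · obtain rfl : k = 0 := not_not.1 fun h' => h (Fin.pos_iff_ne_zero.2 h')
    refine gcomm_eq_of_mul_eq ((congrArg QuotientGroup.mk (lastCol_mul_d _)).trans ?_)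
    simp [corner, params]
  · obtain rfl : k = 0 := not_not.1 fun h' => h (Fin.pos_iff_ne_zero.2 h')
    refine gcomm_eq_of_mul_eq ((congrArg QuotientGroup.mk (lastCol_mul_d _)).trans ?_)
    simp [corner, params, ← mul_assoc]
    norm_num

/-- The parameter that is the image of the corner transvection under the standard choice. -/
def unitParam {G : Type*} (p : ParamIndex (m + 2) → G) : G :=
  p (Sum.inl ⟨(0, Fin.last _), zero_lt_last'⟩)

theorem unitParam_params : unitParam (params (m + 2) F) = corner 1 := rfl

/-- Tuples of elements that represent triangular matrices with non-zero diagonal entries. -/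
def TriTuple {G : Type*} [Group G] (x : Fin (m + 2) × Fin (m + 2) → G) : Prop :=
  (∀ k, CentralizesComm (x k)) ∧ (∀ i j, j < i → x (i, j) = 1) ∧ ∀ i, x (i, i) ≠ 1

/-- The relation `θ` between tuples representing a matrix and elements of the group: for the
standard parameters, `y` is the class of the matrix represented by `x`. -/
def Represents {G : Type*} [Group G] (p : ParamIndex (m + 2) → G)
    (x : Fin (m + 2) × Fin (m + 2) → G) (y : G) : Prop :=
  TriTuple x ∧ ∃ g, g * unitParam p = x (Fin.last _, Fin.last _) * g ∧
    ∀ k, k ≠ Fin.last _ → ∀ i,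
      g * entryElt p y k i = x (k, i) ^ entryFactor k i * g

/-- The tuple of corner elements that represents a matrix over the field with unit `corner u`. -/
noncomputable def cornerTuple (u : F) (M : T (m + 2) F) :
    Fin (m + 2) × Fin (m + 2) → PT (m + 2) F :=
  fun k => corner (u * entry M k.1 k.2)

/-- Tuples are read relative to an arbitrary unit `corner u`, since a good parameter tuple need not
have `corner 1` as its unit. -/
theorem triTuple_iff (h2 : (2 : F) ≠ 0) {u : F} (hu : u ≠ 0)
    {x : Fin (m + 2) × Fin (m + 2) → PT (m + 2) F} :
    TriTuple x ↔ ∃ M : T (m + 2) F, x = cornerTuple u M := by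
  constructor
  · rintro ⟨hx, hl, hd⟩
    choose a ha using fun k => (centralizesComm_iff h2).1 (hx k)
    refine ⟨ofMatrix (Matrix.of fun i j => a (i, j) / u) ?_ ?_, ?_⟩
    · intro i j hij
      have := hl i j hij
      rw [ha, corner_eq_one_iff h2] at this
      simp [this]
    · intro i
      have := hd i
      rw [ha, Ne, corner_eq_one_iff h2] at this
      simp [this, hu]
    · funext k
      change _ = corner (u * (a k / u))
      rw [ha, mul_div_cancel₀ _ hu]
  · rintro ⟨M, rfl⟩
    refine ⟨fun k => (centralizesComm_iff h2).2 ⟨_, rfl⟩, fun i j hij => ?_, fun i => ?_⟩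
    · rw [cornerTuple, entry_lower M hij, mul_zero, corner_zero]
    · rw [cornerTuple, Ne, corner_eq_one_iff h2]
      exact mul_ne_zero hu (entry_diag_ne_zero M i)

/-- The element `g` in `Represents` scales the corner by some $s$, and its first equation forces
$s=M_{nn}$. The remaining equations say $M_{nn}\,N_{ki}/N_{nn}=M_{ki}$ for a representative $N$ of
`y`, which is proportionality. -/
theorem represents_params_iff (h2 : (2 : F) ≠ 0) (M : T (m + 2) F) (y : PT (m + 2) F) :
    Represents (params (m + 2) F) (cornerTuple 1 M) y ↔ QuotientGroup.mk M = y := by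
  obtain ⟨N, rfl⟩ := QuotientGroup.mk_surjective y
  have hN := entry_diag_ne_zero N (Fin.last _)
  have hM := entry_diag_ne_zero M (Fin.last _)
  have key : ∀ k, k ≠ Fin.last _ → ∀ i, ∀ (g : PT (m + 2) F) (s : F),
      (∀ a, g * corner a = corner (s * a) * g) →
      (g * entryElt (params (m + 2) F) (QuotientGroup.mk N) k i =
        cornerTuple 1 M (k, i) ^ entryFactor k i * g ↔
        s * (entry N k i / entry N (Fin.last _) (Fin.last _)) = entry M k i) := by
    intro k hk i g s hg
    rw [entryElt_params N k i hk, hg, cornerTuple, corner_pow, mul_left_inj,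
      (corner_injective h2).eq_iff, one_mul, mul_left_comm,
      mul_right_inj' (entryFactor_ne_zero h2 k i)]
  constructor
  · rintro ⟨-, g, hg, h⟩
    obtain ⟨s, hs, hsg⟩ := exists_factor g
    rw [unitParam_params, hsg, cornerTuple, mul_left_inj, (corner_injective h2).eq_iff, mul_one,
      one_mul] at hg
    rw [eq_comm, mk_eq_mk_iff h2]
    refine ⟨s / entry N (Fin.last _) (Fin.last _), div_ne_zero hs hN, fun k i => ?_⟩
    by_cases hk : k = Fin.last _
    · by_cases hi : i = Fin.last _
      · rw [hk, hi, div_mul_cancel₀ _ hN, hg]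
      · have := Fin.lt_last_iff_ne_last.2 hi
        rw [hk, entry_lower M this, entry_lower N this, mul_zero]
    · rw [← (key k hk i g s hsg).1 (h k hk i)]
      ring
  · intro h
    obtain ⟨s, hs, hMN⟩ := (mk_eq_mk_iff h2).1 h
    refine ⟨(triTuple_iff h2 one_ne_zero).2 ⟨M, rfl⟩, ?_⟩
    obtain ⟨g, hg⟩ := exists_mul_corner (m := m) (entry M (Fin.last _) (Fin.last _)) hM
    refine ⟨g, ?_, fun k hk i => (key k hk i g _ hg).2 ?_⟩
    · rw [unitParam_params, hg, cornerTuple, mul_one, one_mul]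
    · rw [hMN, hMN]
      field_simp

end Coordinates

/-! ### Parameters for which the representation of matrices is an isomorphism -/

section GoodParams

variable {m : ℕ}

/-- Multiplication in the field with unit `u` that is interpreted on the corner subgroup. -/
def FieldMul {G : Type*} [Group G] (u x y z : G) : Prop :=
  (x = 1 ∧ z = 1) ∨ ∃ g, g * u = x * g ∧ g * y = z * g

/-- The tuple `x''` represents the product of the matrices represented by `x` and `x'`. -/
def TupleMul {G : Type*} [Group G] (u : G) (x x' x'' : Fin (m + 2) × Fin (m + 2) → G) : Prop :=
  ∃ w : (Fin (m + 2) × Fin (m + 2)) × Fin (m + 2) → G,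
    (∀ k, CentralizesComm (w k)) ∧
    (∀ k, FieldMul u (x (k.1.1, k.2)) (x' (k.2, k.1.2)) (w k)) ∧
    ∀ k, x'' k = ((List.finRange (m + 2)).map fun l => w (k, l)).prod

/-- The tuple `x` represents a scalar matrix. -/
def ScalarTuple {G : Type*} [Group G] (x : Fin (m + 2) × Fin (m + 2) → G) : Prop :=
  (∀ i, x (i, i) = x (0, 0)) ∧ ∀ i j, i ≠ j → x (i, j) = 1

/-- The tuple that represents the transvection with corner entry `z`, over the field with unit
`u`. -/
def transvectionTuple {G : Type*} [Group G] (u z : G) (k : Fin (m + 2) × Fin (m + 2)) : G :=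
  if k.1 = k.2 then u else if k.1 = 0 ∧ k.2 = Fin.last _ then z else 1

/-- The first-order condition on the parameters: `Represents p` defines an isomorphism from the
triangular group over the field interpreted on the corner subgroup, modulo its centre, onto the
group itself, and this isomorphism is the natural one on the corner subgroup. -/
structure GoodParams {G : Type*} [Group G] (p : ParamIndex (m + 2) → G) : Prop where
  centralizes : CentralizesComm (unitParam p)
  ne_one : unitParam p ≠ 1
  total : ∀ x : Fin (m + 2) × Fin (m + 2) → G, TriTuple x → ∃ y, Represents p x y
  unique : ∀ x : Fin (m + 2) × Fin (m + 2) → G, ∀ y y' : G,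
    Represents p x y → Represents p x y' → y = y'
  surjective : ∀ y : G, ∃ x : Fin (m + 2) × Fin (m + 2) → G, Represents p x y
  kernel : ∀ x : Fin (m + 2) × Fin (m + 2) → G, TriTuple x → (Represents p x 1 ↔ ScalarTuple x)
  mul : ∀ x x' x'' : Fin (m + 2) × Fin (m + 2) → G, ∀ y y' : G, Represents p x y →
    Represents p x' y' → TupleMul (unitParam p) x x' x'' → Represents p x'' (y * y')
  corner : ∀ z : G, CentralizesComm z → Represents p (transvectionTuple (unitParam p) z) z

variable {F : Type*} [Field F]

/-- If `g` scales the corner by $s$, then $su=a$ and $sb=c$; eliminate $s$. The case $a=0$ needs its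
own alternative, as no conjugate of `corner u` is trivial. -/
theorem fieldMul_corner (h2 : (2 : F) ≠ 0) {u : F} (hu : u ≠ 0) (a b c : F) :
    FieldMul (corner u : PT (m + 2) F) (corner a) (corner b) (corner c) ↔ a * b = c * u := by
  constructor
  · rintro (⟨ha, hc⟩ | ⟨g, hg, hg'⟩)
    · rw [corner_eq_one_iff h2] at ha hc
      rw [ha, hc, zero_mul, zero_mul]
    · obtain ⟨s, -, hs⟩ := exists_factor g
      rw [hs, mul_left_inj, (corner_injective h2).eq_iff] at hg hg'
      rw [← hg, ← hg']
      ring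
  · intro h
    by_cases ha : a = 0
    · refine Or.inl ⟨(corner_eq_one_iff h2).2 ha, (corner_eq_one_iff h2).2 ?_⟩
      rw [ha, zero_mul] at h
      exact (mul_eq_zero.1 h.symm).resolve_right hu
    · obtain ⟨g, hg⟩ := exists_mul_corner (m := m) (a / u) (div_ne_zero ha hu)
      refine Or.inr ⟨g, ?_, ?_⟩
      · rw [hg, div_mul_cancel₀ _ hu]
      · rw [hg, div_mul_eq_mul_div, h, mul_div_cancel_right₀ _ hu]

/-- The auxiliary tuple `w` holds the products of single entries; sums in the field are products in
the corner subgroup. -/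
theorem tupleMul_cornerTuple (h2 : (2 : F) ≠ 0) {u : F} (hu : u ≠ 0) (M N : T (m + 2) F)
    (x : Fin (m + 2) × Fin (m + 2) → PT (m + 2) F) :
    TupleMul (corner u) (cornerTuple u M) (cornerTuple u N) x ↔ x = cornerTuple u (M * N) := by
  have key : ∀ k : Fin (m + 2) × Fin (m + 2), cornerTuple u (M * N) k =
      ((List.finRange (m + 2)).map fun l =>
        (corner (u * (entry M k.1 l * entry N l k.2)) : PT (m + 2) F)).prod := by
    intro k
    rw [cornerTuple, entry_mul, Finset.mul_sum, Fin.sum_univ_def, corner_list_sum, List.map_map]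
    rfl
  constructor
  · rintro ⟨w, hw, hm, hx⟩
    funext k
    rw [hx, key]
    refine congrArg List.prod (List.map_congr_left fun l _ => ?_)
    obtain ⟨c, hc⟩ := (centralizesComm_iff h2).1 (hw (k, l))
    have := hm (k, l)
    rw [hc, cornerTuple, cornerTuple, fieldMul_corner h2 hu] at this
    rw [hc]
    congr 1
    apply mul_right_cancel₀ hu
    rw [← this]
    ring
  · rintro rfl
    refine ⟨fun k => corner (u * (entry M k.1.1 k.2 * entry N k.2 k.1.2)),
      fun k => (centralizesComm_iff h2).2 ⟨_, rfl⟩, fun k => ?_, key⟩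
    rw [cornerTuple, cornerTuple, fieldMul_corner h2 hu]
    ring

theorem scalarTuple_cornerTuple (h2 : (2 : F) ≠ 0) {u : F} (hu : u ≠ 0) (M : T (m + 2) F) :
    ScalarTuple (cornerTuple u M) ↔ M ∈ Subgroup.center (T (m + 2) F) := by
  rw [mem_center_iff_scalar h2]
  simp only [ScalarTuple, cornerTuple, (corner_injective h2).eq_iff, corner_eq_one_iff h2,
    mul_right_inj' hu, mul_eq_zero, hu, false_or]
  constructor
  · rintro ⟨h1, h3⟩ i j
    split_ifs with h
    · rw [← h, h1]
    · exact h3 i j h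
  · intro h
    exact ⟨fun i => by rw [h, if_pos rfl], fun i j hij => by rw [h, if_neg hij]⟩

theorem transvectionTuple_corner (u a : F) :
    (transvectionTuple (corner u) (corner (u * a)) : _ → PT (m + 2) F) =
      cornerTuple u (tv 0 (Fin.last _) zero_lt_last' a) := by
  funext k
  rw [transvectionTuple, cornerTuple, entry_tv]
  by_cases hk : k.1 = k.2
  · have h1 : ¬ (0 = k.1 ∧ Fin.last (m + 1) = k.2) := by
      rintro ⟨h, h'⟩
      rw [← h, ← h'] at hk
      exact zero_lt_last'.ne hk
    rw [if_pos hk, if_pos hk, if_neg h1]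
    simp
  · rw [if_neg hk, if_neg hk]
    by_cases h : k.1 = 0 ∧ k.2 = Fin.last _
    · rw [if_pos h, if_pos ⟨h.1.symm, h.2.symm⟩, zero_add]
    · rw [if_neg h, if_neg fun h' => h ⟨h'.1.symm, h'.2.symm⟩, add_zero, mul_zero, corner_zero]

theorem goodParams_params (h2 : (2 : F) ≠ 0) : GoodParams (params (m + 2) F) where
  centralizes := (centralizesComm_iff h2).2 ⟨1, rfl⟩
  ne_one h := one_ne_zero ((corner_eq_one_iff h2).1 h)
  total x hx := by
    obtain ⟨M, rfl⟩ := (triTuple_iff h2 one_ne_zero).1 hx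
    exact ⟨_, (represents_params_iff h2 M _).2 rfl⟩
  unique x y y' h h' := by
    obtain ⟨M, rfl⟩ := (triTuple_iff h2 one_ne_zero).1 h.1
    rw [represents_params_iff h2] at h h'
    exact h.symm.trans h'
  surjective y := by
    obtain ⟨M, rfl⟩ := QuotientGroup.mk_surjective y
    exact ⟨_, (represents_params_iff h2 M _).2 rfl⟩
  kernel x hx := by
    obtain ⟨M, rfl⟩ := (triTuple_iff h2 one_ne_zero).1 hx
    rw [represents_params_iff h2, scalarTuple_cornerTuple h2 one_ne_zero,
      QuotientGroup.eq_one_iff]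
  mul x x' x'' y y' h h' hm := by
    obtain ⟨M, rfl⟩ := (triTuple_iff h2 one_ne_zero).1 h.1
    obtain ⟨N, rfl⟩ := (triTuple_iff h2 one_ne_zero).1 h'.1
    rw [unitParam_params, tupleMul_cornerTuple h2 one_ne_zero] at hm
    rw [represents_params_iff h2] at h h'
    rw [hm, represents_params_iff h2, ← h, ← h']
    rfl
  corner z hz := by
    obtain ⟨a, rfl⟩ := (centralizesComm_iff h2).1 hz
    have := transvectionTuple_corner (m := m) 1 a
    rw [one_mul] at this
    rw [unitParam_params, this, represents_params_iff h2]
    rfl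

/-- The clauses of `GoodParams` make `Represents p` the graph of a surjective homomorphism from `T`
with kernel the centre, so the first isomorphism theorem yields `e`; the clause `corner` computes
`e` on the corner subgroup. -/
theorem GoodParams.exists_mulEquiv (h2 : (2 : F) ≠ 0) {p : ParamIndex (m + 2) → PT (m + 2) F}
    (hp : GoodParams p) :
    ∃ u : F, u ≠ 0 ∧ unitParam p = TriBi.corner u ∧ ∃ e : PT (m + 2) F ≃* PT (m + 2) F,
      (∀ M y, Represents p (cornerTuple u M) y ↔ e (QuotientGroup.mk M) = y) ∧
      ∀ a, e (TriBi.corner a) = TriBi.corner (u * a) := by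
  obtain ⟨u, hu⟩ := (centralizesComm_iff h2).1 hp.centralizes
  have hu0 : u ≠ 0 := fun h => hp.ne_one (hu.trans ((corner_eq_one_iff h2).2 h))
  have htri : ∀ M : T (m + 2) F, TriTuple (cornerTuple u M) := fun M =>
    (triTuple_iff h2 hu0).2 ⟨M, rfl⟩
  choose f hf using fun M : T (m + 2) F => hp.total _ (htri M)
  have hf' : ∀ M y, Represents p (cornerTuple u M) y ↔ f M = y := fun M y =>
    ⟨fun h => hp.unique _ _ _ (hf M) h, fun h => h ▸ hf M⟩
  let φ : T (m + 2) F →* PT (m + 2) F := MonoidHom.mk' f fun M N => (hf' _ _).1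
    (hp.mul _ _ _ _ _ (hf M) (hf N) (by rw [hu, tupleMul_cornerTuple h2 hu0]))
  have hφs : Function.Surjective φ := by
    intro y
    obtain ⟨x, hx⟩ := hp.surjective y
    obtain ⟨M, rfl⟩ := (triTuple_iff h2 hu0).1 hx.1
    exact ⟨M, (hf' _ _).1 hx⟩
  have hker : Subgroup.center (T (m + 2) F) = φ.ker := by
    ext M
    rw [← scalarTuple_cornerTuple h2 hu0, ← hp.kernel _ (htri M), hf', MonoidHom.mem_ker]
    rfl
  refine ⟨u, hu0, hu, (QuotientGroup.quotientMulEquivOfEq hker).trans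
    (QuotientGroup.quotientKerEquivOfSurjective φ hφs), fun M y => hf' M y, fun a => ?_⟩
  change f (tv 0 (Fin.last _) zero_lt_last' a) = _
  rw [← hf', ← transvectionTuple_corner, ← hu]
  exact hp.corner _ ((centralizesComm_iff h2).2 ⟨_, rfl⟩)

end GoodParams

/-! ### Definability of the conditions on parameters -/

section DefinableConditions

variable {m : ℕ} {G : Type*} [Group G] {α : Type}

/-- As in the lemmas on `FieldMul`, `Represents` and `TupleMul`, definability is proved with
variables as arguments, and terms are substituted afterwards, so bound variables never mix with
them. -/
theorem DefPred.centralizesComm {f : (α → G) → G} (hf : DefTerm groupLang f) :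
    DefPred groupLang (fun v => CentralizesComm (f v)) := by
  have : DefPred groupLang (fun v : Unit → G => CentralizesComm (v ())) := by
    refine DefPred.forall (DefPred.forall ?_)
    exact DefPred.eq ((DefTerm.var _).gmul ((DefTerm.var _).gcomm (DefTerm.var _)))
      (((DefTerm.var _).gcomm (DefTerm.var _)).gmul (DefTerm.var _))
  exact this.subst fun _ => hf

theorem DefPred.fieldMul {f₁ f₂ f₃ f₄ : (α → G) → G} (h₁ : DefTerm groupLang f₁)
    (h₂ : DefTerm groupLang f₂) (h₃ : DefTerm groupLang f₃) (h₄ : DefTerm groupLang f₄) :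
    DefPred groupLang (fun v => FieldMul (f₁ v) (f₂ v) (f₃ v) (f₄ v)) := by
  have : DefPred groupLang (fun v : Fin 4 → G => FieldMul (v 0) (v 1) (v 2) (v 3)) := by
    refine ((DefPred.eq (DefTerm.var _) DefTerm.gone).and
      (DefPred.eq (DefTerm.var _) DefTerm.gone)).or (DefPred.exists ?_)
    exact (DefPred.eq ((DefTerm.var _).gmul (DefTerm.var _))
      ((DefTerm.var _).gmul (DefTerm.var _))).and
      (DefPred.eq ((DefTerm.var _).gmul (DefTerm.var _)) ((DefTerm.var _).gmul (DefTerm.var _)))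
  have hs : ∀ k : Fin 4, DefTerm groupLang ((![f₁, f₂, f₃, f₄] : Fin 4 → (α → G) → G) k) := by
    intro k
    fin_cases k
    exacts [h₁, h₂, h₃, h₄]
  exact this.subst hs

theorem DefPred.triTuple {x : Fin (m + 2) × Fin (m + 2) → (α → G) → G}
    (hx : ∀ k, DefTerm groupLang (x k)) :
    DefPred groupLang (fun v => TriTuple (fun k => x k v)) :=
  (DefPred.conj fun k => DefPred.centralizesComm (hx k)).and
    ((DefPred.conj fun _ => DefPred.conj fun _ => DefPred.ofImp fun _ =>
      DefPred.eq (hx _) DefTerm.gone).and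
    (DefPred.conj fun _ => DefPred.ne (hx _) DefTerm.gone))

theorem DefPred.scalarTuple {x : Fin (m + 2) × Fin (m + 2) → (α → G) → G}
    (hx : ∀ k, DefTerm groupLang (x k)) :
    DefPred groupLang (fun v => ScalarTuple (fun k => x k v)) :=
  (DefPred.conj fun _ => DefPred.eq (hx _) (hx _)).and
    (DefPred.conj fun _ => DefPred.conj fun _ => DefPred.ofImp fun _ =>
      DefPred.eq (hx _) DefTerm.gone)

theorem DefTerm.entryElt {p : ParamIndex (m + 2) → (α → G) → G} {y : (α → G) → G}
    (hp : ∀ i, DefTerm groupLang (p i)) (hy : DefTerm groupLang y) (k i : Fin (m + 2)) :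
    DefTerm groupLang (fun v => TriBi.entryElt (fun i => p i v) (y v) k i) := by
  have hcol : DefTerm groupLang (fun v => colElt (fun i => p i v) (y v) i) := by
    unfold colElt
    by_cases h : i < Fin.last (m + 1)
    · simp only [h, dite_true]
      exact (hy.gmul (hp _)).gmul hy.ginv
    · simp only [h, dite_false]
      exact hy.gcomm (hp _)
  unfold TriBi.entryElt
  by_cases h : 0 < k
  · simp only [h, dite_true]
    exact (hp _).gcomm hcol
  · simp only [h, dite_false]
    exact hcol.gcomm (hp _)

theorem DefPred.represents {p : ParamIndex (m + 2) → (α → G) → G}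
    {x : Fin (m + 2) × Fin (m + 2) → (α → G) → G} {y : (α → G) → G}
    (hp : ∀ i, DefTerm groupLang (p i)) (hx : ∀ k, DefTerm groupLang (x k))
    (hy : DefTerm groupLang y) :
    DefPred groupLang (fun v => Represents (fun i => p i v) (fun k => x k v) (y v)) := by
  have : DefPred groupLang
      (fun v : (ParamIndex (m + 2) ⊕ Fin (m + 2) × Fin (m + 2)) ⊕ Unit → G =>
        Represents (fun i => v (Sum.inl (Sum.inl i))) (fun k => v (Sum.inl (Sum.inr k)))
          (v (Sum.inr ()))) := by
    refine (DefPred.triTuple fun _ => DefTerm.var _).and (DefPred.exists ?_)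
    refine (DefPred.eq ((DefTerm.var _).gmul (DefTerm.var _))
      ((DefTerm.var _).gmul (DefTerm.var _))).and ?_
    refine DefPred.conj fun k => DefPred.ofImp fun _ => DefPred.conj fun i => ?_
    exact DefPred.eq ((DefTerm.var _).gmul
        (DefTerm.entryElt (fun _ => DefTerm.var _) (DefTerm.var _) k i))
      (((DefTerm.var _).gpow _).gmul (DefTerm.var _))
  have hs : ∀ k, DefTerm groupLang (Sum.elim (Sum.elim p x) (fun _ : Unit => y) k) := by
    rintro ((i | k) | _)
    exacts [hp i, hx k, hy]
  exact this.subst hs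

theorem DefPred.tupleMul {u : (α → G) → G} {x x' x'' : Fin (m + 2) × Fin (m + 2) → (α → G) → G}
    (hu : DefTerm groupLang u) (hx : ∀ k, DefTerm groupLang (x k))
    (hx' : ∀ k, DefTerm groupLang (x' k)) (hx'' : ∀ k, DefTerm groupLang (x'' k)) :
    DefPred groupLang (fun v => TupleMul (u v) (fun k => x k v) (fun k => x' k v)
      (fun k => x'' k v)) := by
  have : DefPred groupLang
      (fun v : (((Fin (m + 2) × Fin (m + 2)) ⊕ (Fin (m + 2) × Fin (m + 2))) ⊕
          (Fin (m + 2) × Fin (m + 2))) ⊕ Unit → G =>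
        TupleMul (v (Sum.inr ())) (fun k => v (Sum.inl (Sum.inl (Sum.inl k))))
          (fun k => v (Sum.inl (Sum.inl (Sum.inr k)))) (fun k => v (Sum.inl (Sum.inr k)))) := by
    refine DefPred.existsTuple ?_
    refine (DefPred.conj fun _ => DefPred.centralizesComm (DefTerm.var _)).and
      ((DefPred.conj fun _ => DefPred.fieldMul (DefTerm.var _) (DefTerm.var _) (DefTerm.var _)
        (DefTerm.var _)).and (DefPred.conj fun _ => DefPred.eq (DefTerm.var _)
          (DefTerm.glistProd (fun _ => DefTerm.var _) _)))
  have hs : ∀ k, DefTerm groupLang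
      (Sum.elim (Sum.elim (Sum.elim x x') x'') (fun _ : Unit => u) k) := by
    rintro (((k | k) | k) | _)
    exacts [hx k, hx' k, hx'' k, hu]
  exact this.subst hs

theorem DefTerm.transvectionTuple {u z : (α → G) → G} (hu : DefTerm groupLang u)
    (hz : DefTerm groupLang z) (k : Fin (m + 2) × Fin (m + 2)) :
    DefTerm groupLang (fun v => TriBi.transvectionTuple (u v) (z v) k) := by
  unfold TriBi.transvectionTuple
  split_ifs
  exacts [hu, hz, DefTerm.gone]

theorem defPred_goodParams :
    DefPred groupLang (fun p : ParamIndex (m + 2) → G => GoodParams p) := by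
  have h1 : DefPred groupLang
      (fun p : ParamIndex (m + 2) → G => CentralizesComm (unitParam p)) :=
    DefPred.centralizesComm (DefTerm.var _)
  have h2 : DefPred groupLang (fun p : ParamIndex (m + 2) → G => unitParam p ≠ 1) :=
    DefPred.ne (DefTerm.var _) DefTerm.gone
  have h3 : DefPred groupLang (fun p : ParamIndex (m + 2) → G =>
      ∀ x : Fin (m + 2) × Fin (m + 2) → G, TriTuple x → ∃ y, Represents p x y) :=
    DefPred.forallTuple ((DefPred.triTuple fun _ => DefTerm.var _).imp
      (DefPred.exists (DefPred.represents (fun _ => DefTerm.var _) (fun _ => DefTerm.var _)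
        (DefTerm.var _))))
  have h4 : DefPred groupLang (fun p : ParamIndex (m + 2) → G =>
      ∀ x : Fin (m + 2) × Fin (m + 2) → G, ∀ y y' : G,
        Represents p x y → Represents p x y' → y = y') :=
    DefPred.forallTuple (DefPred.forall (DefPred.forall
      ((DefPred.represents (fun _ => DefTerm.var _) (fun _ => DefTerm.var _)
        (DefTerm.var _)).imp
      ((DefPred.represents (fun _ => DefTerm.var _) (fun _ => DefTerm.var _)
        (DefTerm.var _)).imp (DefPred.eq (DefTerm.var _) (DefTerm.var _))))))
  have h5 : DefPred groupLang (fun p : ParamIndex (m + 2) → G =>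
      ∀ y : G, ∃ x : Fin (m + 2) × Fin (m + 2) → G, Represents p x y) :=
    DefPred.forall (DefPred.existsTuple (DefPred.represents (fun _ => DefTerm.var _)
      (fun _ => DefTerm.var _) (DefTerm.var _)))
  -- The equivalence in `kernel` is split into two implications, the connective available for
  -- `DefPred`.
  have h6 : DefPred groupLang (fun p : ParamIndex (m + 2) → G =>
      ∀ x : Fin (m + 2) × Fin (m + 2) → G, TriTuple x →
        ((Represents p x 1 → ScalarTuple x) ∧ (ScalarTuple x → Represents p x 1))) := by
    have hr : DefPred groupLang
        (fun w : ParamIndex (m + 2) ⊕ Fin (m + 2) × Fin (m + 2) → G =>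
          Represents (fun i => w (Sum.inl i)) (fun k => w (Sum.inr k)) 1) :=
      DefPred.represents (fun _ => DefTerm.var _) (fun _ => DefTerm.var _) DefTerm.gone
    exact DefPred.forallTuple ((DefPred.triTuple fun _ => DefTerm.var _).imp
      ((hr.imp (DefPred.scalarTuple fun _ => DefTerm.var _)).and
        ((DefPred.scalarTuple fun _ => DefTerm.var _).imp hr)))
  have h7 : DefPred groupLang (fun p : ParamIndex (m + 2) → G =>
      ∀ x x' x'' : Fin (m + 2) × Fin (m + 2) → G, ∀ y y' : G, Represents p x y →
        Represents p x' y' → TupleMul (unitParam p) x x' x'' → Represents p x'' (y * y')) :=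
    DefPred.forallTuple (DefPred.forallTuple (DefPred.forallTuple (DefPred.forall
      (DefPred.forall
        ((DefPred.represents (fun _ => DefTerm.var _) (fun _ => DefTerm.var _)
          (DefTerm.var _)).imp
        ((DefPred.represents (fun _ => DefTerm.var _) (fun _ => DefTerm.var _)
          (DefTerm.var _)).imp
        ((DefPred.tupleMul (DefTerm.var _) (fun _ => DefTerm.var _) (fun _ => DefTerm.var _)
          (fun _ => DefTerm.var _)).imp
        (DefPred.represents (fun _ => DefTerm.var _) (fun _ => DefTerm.var _)
          ((DefTerm.var _).gmul (DefTerm.var _))))))))))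
  have h8 : DefPred groupLang (fun p : ParamIndex (m + 2) → G =>
      ∀ z : G, CentralizesComm z → Represents p (transvectionTuple (unitParam p) z) z) :=
    DefPred.forall ((DefPred.centralizesComm (DefTerm.var _)).imp
      (DefPred.represents (fun _ => DefTerm.var _)
        (fun k => DefTerm.transvectionTuple (DefTerm.var _) (DefTerm.var _) k) (DefTerm.var _)))
  refine (h1.and (h2.and (h3.and (h4.and (h5.and (h6.and (h7.and h8))))))).congr fun p => ?_
  exact ⟨fun ⟨a, b, c, d, e, f, g, h⟩ => ⟨a, b, c, d, e, fun x hx => ⟨(f x hx).1, (f x hx).2⟩,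
    g, h⟩, fun ⟨a, b, c, d, e, f, g, h⟩ => ⟨a, b, c, d, e, fun x hx => ⟨(f x hx).1, (f x hx).2⟩,
    g, h⟩⟩

end DefinableConditions

/-! ### Transport of coordinate maps -/

section Transport

variable {L K : FirstOrder.Language.{0, 0}} {ι : Type} {Γ : InterpCode L K ι}
  {A A' B B' : Type*} [L.Structure A] [L.Structure A'] [K.Structure B] [K.Structure B']

theorem InterpCode.IsCoordinateMap.postcomp {p : ι → B} {μ : Γ.Dom p → A}
    (h : Γ.IsCoordinateMap p μ) (e : L.Equiv A A') :
    Γ.IsCoordinateMap p (fun x => e (μ x)) where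
  surjective := e.surjective.comp h.surjective
  eqv_iff x y := (h.eqv_iff x y).trans e.injective.eq_iff.symm
  fn_iff f xs y := by
    rw [h.fn_iff, ← e.injective.eq_iff, e.map_fun]
    rfl
  rel_iff r xs := by
    rw [h.rel_iff, ← e.map_rel]
    rfl

theorem realize_equiv_comp {α : Type} (φ : K.Formula α) (e : K.Equiv B B') (v : α → B) :
    φ.Realize (fun i => e (v i)) ↔ φ.Realize v :=
  FirstOrder.Language.StrongHomClass.realize_formula e φ

theorem InterpCode.mem_dom_comp (e : K.Equiv B B') (p : ι → B) (x : Fin Γ.dim → B) :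
    (fun i => e (x i)) ∈ Γ.Dom (fun i => e (p i)) ↔ x ∈ Γ.Dom p := by
  change Γ.dom.Realize _ ↔ Γ.dom.Realize _
  rw [← realize_equiv_comp Γ.dom e]
  exact iff_of_eq (congrArg _ (funext fun i => by cases i <;> rfl))

/-- Formulas are invariant under isomorphisms of the base structure. The map `μ` is defined on all
tuples, so precomposing it needs no membership proofs. -/
theorem InterpCode.IsCoordinateMap.precomp {p : ι → B} (e : K.Equiv B B')
    {μ : (Fin Γ.dim → B') → A} (h : Γ.IsCoordinateMap (fun i => e (p i)) (fun x => μ x.1)) :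
    Γ.IsCoordinateMap p (fun x => μ fun i => e (x.1 i)) where
  surjective a := by
    obtain ⟨x, rfl⟩ := h.surjective a
    have hx : (fun i => e (e.symm (x.1 i))) = x.1 := funext fun i => e.apply_symm_apply _
    refine ⟨⟨fun i => e.symm (x.1 i), ?_⟩, ?_⟩
    · rw [← mem_dom_comp e, hx]
      exact x.2
    · exact congrArg μ hx
  eqv_iff x y := by
    refine Iff.trans ?_ (h.eqv_iff ⟨_, (mem_dom_comp e p x.1).2 x.2⟩
      ⟨_, (mem_dom_comp e p y.1).2 y.2⟩)
    rw [← realize_equiv_comp Γ.eqv e]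
    exact iff_of_eq (congrArg _ (funext fun i => by rcases i with i | i | i <;> rfl))
  fn_iff f xs y := by
    refine Iff.trans ?_ (h.fn_iff f (fun k => ⟨_, (mem_dom_comp e p (xs k).1).2 (xs k).2⟩)
      ⟨_, (mem_dom_comp e p y.1).2 y.2⟩)
    rw [← realize_equiv_comp (Γ.fn f) e]
    exact iff_of_eq (congrArg _ (funext fun i => by rcases i with i | i | i <;> rfl))
  rel_iff r xs := by
    refine Iff.trans ?_ (h.rel_iff r (fun k => ⟨_, (mem_dom_comp e p (xs k).1).2 (xs k).2⟩))
    rw [← realize_equiv_comp (Γ.rel r) e]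
    exact iff_of_eq (congrArg _ (funext fun i => by rcases i with i | i <;> rfl))

end Transport

/-! ### The field interpreted in the group -/

section FieldCode

variable {m : ℕ}

/-- The graphs of the ring operations on the corner subgroup. -/
def ringGraph {G : Type*} [Group G] {k : ℕ} (f : FirstOrder.Language.ring.Functions k) (u : G)
    (x : Fin k → G) (y : G) : Prop :=
  match k, f, x with
  | _, .add, x => x 0 * x 1 = y
  | _, .mul, x => FieldMul u (x 0) (x 1) y
  | _, .neg, x => (x 0)⁻¹ = y
  | _, .zero, _ => 1 = y
  | _, .one, _ => u = y

theorem defPred_ringGraph (G : Type*) [Group G] {k : ℕ}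
    (f : FirstOrder.Language.ring.Functions k) :
    DefPred groupLang (fun v : ParamIndex (m + 2) ⊕ ((Fin k × Fin 1) ⊕ Fin 1) → G =>
      ringGraph f (unitParam fun i => v (Sum.inl i)) (fun i => v (Sum.inr (Sum.inl (i, 0))))
        (v (Sum.inr (Sum.inr 0)))) := by
  cases f
  · exact DefPred.eq ((DefTerm.var _).gmul (DefTerm.var _)) (DefTerm.var _)
  · exact DefPred.fieldMul (DefTerm.var _) (DefTerm.var _) (DefTerm.var _) (DefTerm.var _)
  · exact DefPred.eq (DefTerm.var _).ginv (DefTerm.var _)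
  · exact DefPred.eq DefTerm.gone (DefTerm.var _)
  · exact DefPred.eq (DefTerm.var _) (DefTerm.var _)

theorem defPred_fieldDom (m : ℕ) (G : Type*) [Group G] :
    DefPred groupLang (fun v : ParamIndex (m + 2) ⊕ Fin 1 → G =>
      CentralizesComm (v (Sum.inr 0))) :=
  DefPred.centralizesComm (DefTerm.var _)

theorem defPred_fieldEqv (m : ℕ) (G : Type*) [Group G] :
    DefPred groupLang (fun v : ParamIndex (m + 2) ⊕ (Fin 1 ⊕ Fin 1) → G =>
      v (Sum.inr (Sum.inl 0)) = v (Sum.inr (Sum.inr 0))) :=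
  DefPred.eq (DefTerm.var _) (DefTerm.var _)

/-- The code of the interpretation of the field on the corner subgroup of the group `G`. -/
noncomputable def fieldCode (m : ℕ) (G : Type*) [Group G] :
    InterpCode FirstOrder.Language.ring groupLang (ParamIndex (m + 2)) where
  dim := 1
  dom := (defPred_fieldDom m G).choose
  eqv := (defPred_fieldEqv m G).choose
  fn f := (defPred_ringGraph G f).choose
  rel r := nomatch r

theorem mem_fieldCode_dom {G : Type*} [Group G] (p : ParamIndex (m + 2) → G)
    (x : Fin 1 → G) :
    x ∈ (fieldCode m G).Dom p ↔ CentralizesComm (x 0) :=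
  (defPred_fieldDom m G).choose_spec _

variable {F : Type*} [Field F]

/-- The entry of a corner element. -/
noncomputable def cornerEntry : PT (m + 2) F → F := Function.invFun corner

theorem cornerEntry_corner (h2 : (2 : F) ≠ 0) (a : F) :
    cornerEntry (corner a : PT (m + 2) F) = a :=
  Function.leftInverse_invFun (corner_injective h2) a

/-- With unit `corner u`, the element `corner a` stands for $a/u$: the relation $ab=cu$ becomes
$(a/u)(b/u)=c/u$. -/
theorem isCoordinateMap_fieldCode (h2 : (2 : F) ≠ 0) {p : ParamIndex (m + 2) → PT (m + 2) F}
    {u : F} (hu : u ≠ 0) (hp : unitParam p = corner u) :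
    (fieldCode m (PT (m + 2) F)).IsCoordinateMap p
      (fun x => cornerEntry (x.1 (0 : Fin 1)) / u) where
  surjective a := by
    refine ⟨⟨fun _ => corner (a * u), ?_⟩, ?_⟩
    · exact (mem_fieldCode_dom p _).2 ((centralizesComm_iff h2).2 ⟨_, rfl⟩)
    · simp only [cornerEntry_corner h2]
      exact mul_div_cancel_right₀ a hu
  eqv_iff x y := by
    obtain ⟨a, ha⟩ := (centralizesComm_iff h2).1 ((mem_fieldCode_dom p x.1).1 x.2)
    obtain ⟨b, hb⟩ := (centralizesComm_iff h2).1 ((mem_fieldCode_dom p y.1).1 y.2)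
    refine ((defPred_fieldEqv m _).choose_spec _).trans ?_
    change x.1 (0 : Fin 1) = y.1 (0 : Fin 1) ↔ _
    rw [ha, hb, cornerEntry_corner h2, cornerEntry_corner h2, (corner_injective h2).eq_iff,
      div_left_inj' hu]
  fn_iff {k} f xs y := by
    choose a ha using fun i =>
      (centralizesComm_iff h2).1 ((mem_fieldCode_dom p (xs i).1).1 (xs i).2)
    obtain ⟨b, hb⟩ := (centralizesComm_iff h2).1 ((mem_fieldCode_dom p y.1).1 y.2)
    refine ((defPred_ringGraph _ f).choose_spec _).trans ?_
    change ringGraph f (unitParam p) (fun i => (xs i).1 (0 : Fin 1)) (y.1 (0 : Fin 1)) ↔ _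
    simp only [ha, hb, hp, cornerEntry_corner h2]
    have hinj := corner_injective (m := m) h2
    cases f
    · change corner (a 0) * corner (a 1) = corner b ↔ a 0 / u + a 1 / u = b / u
      rw [← corner_add, hinj.eq_iff, ← add_div, div_left_inj' hu]
    · change FieldMul (corner u) (corner (a 0)) (corner (a 1)) (corner b) ↔
        a 0 / u * (a 1 / u) = b / u
      rw [fieldMul_corner h2 hu, div_mul_div_comm, div_eq_div_iff (mul_ne_zero hu hu) hu,
        ← mul_assoc, mul_left_inj' hu]
    · change (corner (a 0))⁻¹ = corner b ↔ -(a 0 / u) = b / u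
      rw [corner_inv, hinj.eq_iff, ← neg_div, div_left_inj' hu]
    · change 1 = corner b ↔ 0 = b / u
      rw [eq_comm, corner_eq_one_iff h2, eq_comm (a := (0 : F)), div_eq_zero_iff]
      simp [hu]
    · change corner u = corner b ↔ 1 = b / u
      rw [hinj.eq_iff, eq_div_iff hu, one_mul]
  rel_iff r := nomatch r

end FieldCode

/-! ### The group interpreted in the field -/

section MatrixCode

variable {m : ℕ} {F : Type*} [Field F]

/-- The tuple `x` is an upper triangular matrix with non-zero diagonal entries. -/
def TriMatrix (x : Fin (m + 2) × Fin (m + 2) → F) : Prop :=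
  (∀ i j, j < i → x (i, j) = 0) ∧ ∀ i, x (i, i) ≠ 0

/-- The entries of the product of two matrices. -/
def tupleProd (x y : Fin (m + 2) × Fin (m + 2) → F) (k : Fin (m + 2) × Fin (m + 2)) : F :=
  ∑ l, x (k.1, l) * y (l, k.2)

/-- The entries of the identity matrix. -/
def tupleOne (k : Fin (m + 2) × Fin (m + 2)) : F := if k.1 = k.2 then 1 else 0

/-- The tuple `y` is a non-zero multiple of `x`. -/
def Proportional (x y : Fin (m + 2) × Fin (m + 2) → F) : Prop :=
  ∃ s : F, s ≠ 0 ∧ ∀ k, y k = s * x k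

/-- The graphs of the group operations on matrices modulo scalars. -/
def groupGraph {k : ℕ} (f : groupLang.Functions k)
    (x : Fin k → Fin (m + 2) × Fin (m + 2) → F) (y : Fin (m + 2) × Fin (m + 2) → F) : Prop :=
  match k, f, x with
  | _, GroupFunc.mul, x => Proportional (tupleProd (x 0) (x 1)) y
  -- Modulo scalars `y` is the inverse exactly when the product is scalar; no formula for the
  -- inverse matrix is needed.
  | _, GroupFunc.inv, x => Proportional tupleOne (tupleProd (x 0) y)
  | _, GroupFunc.one, _ => Proportional tupleOne y

theorem DefPred.proportional {α : Type} {x y : Fin (m + 2) × Fin (m + 2) → (α → F) → F}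
    (hx : ∀ k, DefTerm FirstOrder.Language.ring (x k))
    (hy : ∀ k, DefTerm FirstOrder.Language.ring (y k)) :
    DefPred FirstOrder.Language.ring
      (fun v => Proportional (fun k => x k v) (fun k => y k v)) := by
  have : DefPred FirstOrder.Language.ring
      (fun v : (Fin (m + 2) × Fin (m + 2)) ⊕ (Fin (m + 2) × Fin (m + 2)) → F =>
        Proportional (fun k => v (Sum.inl k)) (fun k => v (Sum.inr k))) :=
    DefPred.exists ((DefPred.ne (DefTerm.var _) DefTerm.rzero).and
      (DefPred.conj fun _ => DefPred.eq (DefTerm.var _)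
        ((DefTerm.var _).rmul (DefTerm.var _))))
  have hs : ∀ k, DefTerm FirstOrder.Language.ring (Sum.elim x y k) := by
    rintro (k | k)
    exacts [hx k, hy k]
  exact this.subst hs

theorem DefTerm.tupleProd {α : Type} {x y : Fin (m + 2) × Fin (m + 2) → (α → F) → F}
    (hx : ∀ k, DefTerm FirstOrder.Language.ring (x k))
    (hy : ∀ k, DefTerm FirstOrder.Language.ring (y k)) (k : Fin (m + 2) × Fin (m + 2)) :
    DefTerm FirstOrder.Language.ring
      (fun v => TriBi.tupleProd (fun k => x k v) (fun k => y k v) k) :=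
  DefTerm.rsum fun _ => (hx _).rmul (hy _)

theorem DefTerm.tupleOne {α : Type} (k : Fin (m + 2) × Fin (m + 2)) :
    DefTerm FirstOrder.Language.ring (fun _ : α → F => TriBi.tupleOne k) := by
  unfold TriBi.tupleOne
  split_ifs
  exacts [DefTerm.rone, DefTerm.rzero]

theorem DefPred.triMatrix {α : Type} {x : Fin (m + 2) × Fin (m + 2) → (α → F) → F}
    (hx : ∀ k, DefTerm FirstOrder.Language.ring (x k)) :
    DefPred FirstOrder.Language.ring (fun v => TriMatrix (fun k => x k v)) :=
  (DefPred.conj fun _ => DefPred.conj fun _ => DefPred.ofImp fun _ =>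
    DefPred.eq (hx _) DefTerm.rzero).and (DefPred.conj fun _ => DefPred.ne (hx _) DefTerm.rzero)

theorem defPred_matrixDom (m : ℕ) (F : Type*) [Field F] :
    DefPred FirstOrder.Language.ring (fun v : Empty ⊕ Fin ((m + 2) * (m + 2)) → F =>
      TriMatrix (fun k => v (Sum.inr (finProdFinEquiv k)))) :=
  DefPred.triMatrix fun _ => DefTerm.var _

theorem defPred_matrixEqv (m : ℕ) (F : Type*) [Field F] :
    DefPred FirstOrder.Language.ring
      (fun v : Empty ⊕ (Fin ((m + 2) * (m + 2)) ⊕ Fin ((m + 2) * (m + 2))) → F =>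
        Proportional (fun k => v (Sum.inr (Sum.inl (finProdFinEquiv k))))
          (fun k => v (Sum.inr (Sum.inr (finProdFinEquiv k))))) :=
  DefPred.proportional (fun _ => DefTerm.var _) (fun _ => DefTerm.var _)

theorem defPred_groupGraph (m : ℕ) (F : Type*) [Field F] {k : ℕ} (f : groupLang.Functions k) :
    DefPred FirstOrder.Language.ring
      (fun v : Empty ⊕ ((Fin k × Fin ((m + 2) * (m + 2))) ⊕ Fin ((m + 2) * (m + 2))) → F =>
        groupGraph f (fun i k => v (Sum.inr (Sum.inl (i, finProdFinEquiv k))))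
          (fun k => v (Sum.inr (Sum.inr (finProdFinEquiv k))))) := by
  cases f
  · exact DefPred.proportional
      (DefTerm.tupleProd (fun _ => DefTerm.var _) (fun _ => DefTerm.var _))
      (fun _ => DefTerm.var _)
  · exact DefPred.proportional DefTerm.tupleOne
      (DefTerm.tupleProd (fun _ => DefTerm.var _) (fun _ => DefTerm.var _))
  · exact DefPred.proportional DefTerm.tupleOne (fun _ => DefTerm.var _)

/-- The code of the interpretation of `PT_n(F)` in `F` by triangular matrices modulo scalars. -/
noncomputable def matrixCode (m : ℕ) (F : Type*) [Field F] :
    InterpCode groupLang FirstOrder.Language.ring Empty where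
  dim := (m + 2) * (m + 2)
  dom := (defPred_matrixDom m F).choose
  eqv := (defPred_matrixEqv m F).choose
  fn f := (defPred_groupGraph m F f).choose
  rel r := nomatch r

theorem mem_matrixCode_dom (q : Empty → F) (x : Fin ((m + 2) * (m + 2)) → F) :
    x ∈ (matrixCode m F).Dom q ↔ TriMatrix (fun k => x (finProdFinEquiv k)) :=
  (defPred_matrixDom m F).choose_spec _

/-- The tuple of the entries of a triangular matrix. -/
def entryTuple (M : T (m + 2) F) (k : Fin (m + 2) × Fin (m + 2)) : F := entry M k.1 k.2

theorem triMatrix_entryTuple (M : T (m + 2) F) : TriMatrix (entryTuple M) :=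
  ⟨fun _ _ h => entry_lower M h, entry_diag_ne_zero M⟩

theorem triMatrix_iff {x : Fin (m + 2) × Fin (m + 2) → F} :
    TriMatrix x ↔ ∃ M : T (m + 2) F, x = entryTuple M :=
  ⟨fun h => ⟨ofMatrix (Matrix.of fun i j => x (i, j)) (fun _ _ hij => h.1 _ _ hij) h.2, rfl⟩,
    fun ⟨M, hM⟩ => hM ▸ triMatrix_entryTuple M⟩

open Classical in
/-- The class in `PT_n(F)` of the matrix with given entries. -/
noncomputable def matrixClass (x : Fin (m + 2) × Fin (m + 2) → F) : PT (m + 2) F :=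
  if h : TriMatrix x then
    QuotientGroup.mk (ofMatrix (Matrix.of fun i j => x (i, j)) (fun _ _ hij => h.1 _ _ hij) h.2)
  -- An arbitrary default value: the class is compared only for tuples known to be triangular.
  else 1

theorem matrixClass_entryTuple (M : T (m + 2) F) :
    matrixClass (entryTuple M) = QuotientGroup.mk M := by
  rw [matrixClass, dif_pos (triMatrix_entryTuple M)]
  exact congrArg QuotientGroup.mk (T_ext fun _ _ => rfl)

theorem entryTuple_mul (M N : T (m + 2) F) :
    entryTuple (M * N) = tupleProd (entryTuple M) (entryTuple N) :=
  funext fun k => entry_mul M N k.1 k.2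

theorem entryTuple_one : entryTuple (1 : T (m + 2) F) = tupleOne :=
  funext fun k => entry_one k.1 k.2

theorem proportional_entryTuple (h2 : (2 : F) ≠ 0) (M N : T (m + 2) F) :
    Proportional (entryTuple M) (entryTuple N) ↔
      (QuotientGroup.mk M : PT (m + 2) F) = QuotientGroup.mk N := by
  rw [mk_eq_mk_iff h2]
  exact exists_congr fun s => and_congr_right fun _ =>
    ⟨fun h i j => h (i, j), fun h k => h k.1 k.2⟩

theorem isCoordinateMap_matrixCode (h2 : (2 : F) ≠ 0) (q : Empty → F) :
    (matrixCode m F).IsCoordinateMap q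
      (fun x => matrixClass (fun k => x.1 (finProdFinEquiv k))) where
  surjective y := by
    obtain ⟨M, rfl⟩ := QuotientGroup.mk_surjective y
    have h : (fun k => entryTuple M (finProdFinEquiv.symm (finProdFinEquiv k))) =
        entryTuple M := by simp
    refine ⟨⟨fun k => entryTuple M (finProdFinEquiv.symm k),
      (mem_matrixCode_dom q _).2 ?_⟩, ?_⟩
    · rw [h]
      exact triMatrix_entryTuple M
    · exact (congrArg matrixClass h).trans (matrixClass_entryTuple M)
  eqv_iff x y := by
    obtain ⟨M, hM⟩ := triMatrix_iff.1 ((mem_matrixCode_dom q x.1).1 x.2)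
    obtain ⟨N, hN⟩ := triMatrix_iff.1 ((mem_matrixCode_dom q y.1).1 y.2)
    refine ((defPred_matrixEqv m F).choose_spec _).trans ?_
    simp only [hM, hN, matrixClass_entryTuple]
    rw [← proportional_entryTuple h2, ← hM, ← hN]
    rfl
  fn_iff {k} f xs y := by
    choose M hM using fun i => triMatrix_iff.1 ((mem_matrixCode_dom q (xs i).1).1 (xs i).2)
    obtain ⟨N, hN⟩ := triMatrix_iff.1 ((mem_matrixCode_dom q y.1).1 y.2)
    refine ((defPred_groupGraph m F f).choose_spec _).trans ?_
    have hM' : (fun i k => (xs i).1 (finProdFinEquiv k)) = fun i => entryTuple (M i) := funext hM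
    change groupGraph f (fun i k => (xs i).1 (finProdFinEquiv k))
      (fun k => y.1 (finProdFinEquiv k)) ↔ _
    rw [hM']
    simp only [hM, hN, matrixClass_entryTuple]
    cases f
    · change Proportional (tupleProd (entryTuple (M 0)) (entryTuple (M 1))) (entryTuple N) ↔ _
      rw [← entryTuple_mul, proportional_entryTuple h2]
      rfl
    · change Proportional tupleOne (tupleProd (entryTuple (M 0)) (entryTuple N)) ↔
        (QuotientGroup.mk (M 0) : PT (m + 2) F)⁻¹ = QuotientGroup.mk N
      rw [← entryTuple_mul, ← entryTuple_one, proportional_entryTuple h2, inv_eq_iff_mul_eq_one,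
        eq_comm]
      rfl
    · change Proportional tupleOne (entryTuple N) ↔ _
      rw [← entryTuple_one, proportional_entryTuple h2]
      rfl
  rel_iff r := nomatch r

end MatrixCode

/-! ### The compositions of the two interpretations -/

section Composites

variable {m : ℕ} {F : Type*} [Field F]

/-- The matrix `x` is a scalar multiple of a corner transvection, and `a` is the quotient of its
corner entry by the corner entry of `w`, where both matrices are normalised to have diagonal
entries `1`. -/
def CornerRatio (w x : Fin (m + 2) × Fin (m + 2) → F) (a : F) : Prop :=
  TriMatrix x ∧ (∀ i, x (i, i) = x (0, 0)) ∧
    (∀ i j, i ≠ j → ¬ (i = 0 ∧ j = Fin.last _) → x (i, j) = 0) ∧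
    a * w (0, Fin.last _) * x (0, 0) = x (0, Fin.last _) * w (0, 0)

/-- The last equation of `CornerRatio` is
$x_{0,\mathrm{last}}/x_{00}=a\,(w_{0,\mathrm{last}}/w_{00})$ with denominators cleared, and the
second fraction is $u$. -/
theorem cornerRatio_iff (h2 : (2 : F) ≠ 0) {w x : Fin (m + 2) × Fin (m + 2) → F} {u : F}
    (hw : TriMatrix w) (hwu : matrixClass w = corner u) (a : F) :
    CornerRatio w x a ↔ TriMatrix x ∧ matrixClass x = corner (a * u) := by
  refine and_congr_right fun hx => ?_
  obtain ⟨W, rfl⟩ := triMatrix_iff.1 hw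
  obtain ⟨M, rfl⟩ := triMatrix_iff.1 hx
  rw [matrixClass_entryTuple, mk_eq_corner_iff h2] at hwu ⊢
  have hW := entry_diag_ne_zero W 0
  refine and_congr_right fun _ => and_congr_right fun _ => ?_
  simp only [entryTuple]
  rw [hwu.2.2, ← mul_assoc a u, mul_right_comm, mul_left_inj' hW]
  exact eq_comm

theorem defPred_cornerRatio (m : ℕ) (F : Type*) [Field F] :
    DefPred FirstOrder.Language.ring
      (fun v : ((ParamIndex (m + 2) × Fin ((m + 2) * (m + 2))) ⊕ Empty) ⊕
          ((Fin 1 × Fin ((m + 2) * (m + 2))) ⊕ Unit) → F =>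
        CornerRatio
          (fun k => unitParam (fun i => v (Sum.inl (Sum.inl (i, finProdFinEquiv k)))))
          (fun k => v (Sum.inr (Sum.inl (0, finProdFinEquiv k)))) (v (Sum.inr (Sum.inr ())))) :=
  (DefPred.triMatrix fun _ => DefTerm.var _).and
    ((DefPred.conj fun _ => DefPred.eq (DefTerm.var _) (DefTerm.var _)).and
    ((DefPred.conj fun _ => DefPred.conj fun _ => DefPred.ofImp fun _ => DefPred.ofImp fun _ =>
      DefPred.eq (DefTerm.var _) DefTerm.rzero).and
    (DefPred.eq (((DefTerm.var _).rmul (DefTerm.var _)).rmul (DefTerm.var _))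
      ((DefTerm.var _).rmul (DefTerm.var _)))))

theorem defPred_represents (m : ℕ) (G : Type*) [Group G] :
    DefPred groupLang
      (fun v : ((Empty × Fin 1) ⊕ ParamIndex (m + 2)) ⊕
          ((Fin ((m + 2) * (m + 2)) × Fin 1) ⊕ Unit) → G =>
        Represents (fun i => v (Sum.inl (Sum.inr i)))
          (fun k => v (Sum.inr (Sum.inl (finProdFinEquiv k, 0)))) (v (Sum.inr (Sum.inr ())))) :=
  DefPred.represents (fun _ => DefTerm.var _) (fun _ => DefTerm.var _) (DefTerm.var _)

/-- The formula that defines the self-interpretation isomorphism of the field. -/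
noncomputable def fieldIsoFormula (m : ℕ) (F : Type*) [Field F] :
    FirstOrder.Language.ring.Formula
      (((ParamIndex (m + 2) × Fin (matrixCode m F).dim) ⊕ Empty) ⊕
        ((Fin (fieldCode m (PT (m + 2) F)).dim × Fin (matrixCode m F).dim) ⊕ Unit)) :=
  (defPred_cornerRatio m F).choose

/-- The formula that defines the self-interpretation isomorphism of the group. -/
noncomputable def groupIsoFormula (m : ℕ) (F : Type*) [Field F] :
    groupLang.Formula
      (((Empty × Fin (fieldCode m (PT (m + 2) F)).dim) ⊕ ParamIndex (m + 2)) ⊕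
        ((Fin (matrixCode m F).dim × Fin (fieldCode m (PT (m + 2) F)).dim) ⊕ Unit)) :=
  (defPred_represents m (PT (m + 2) F)).choose

/-- The automorphism `e` cancels between `f` and `g`, so the composite reads a corner matrix
relative to the unit in `pStar`. Keeping `e` and `u` general covers both arbitrary and matched
coordinate maps. -/
theorem definesComposite_field (h2 : (2 : F) ≠ 0) {p : ParamIndex (m + 2) → PT (m + 2) F}
    (e : PT (m + 2) F ≃* PT (m + 2) F) {u : F} (hu : u ≠ 0)
    (hp : unitParam p = e (corner u)) {q : Empty → F}
    {f : (fieldCode m (PT (m + 2) F)).Dom p → F}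
    (hf : ∀ x, f x = cornerEntry (e.symm (x.1 (0 : Fin 1))) / u)
    {g : (matrixCode m F).Dom q → PT (m + 2) F}
    (hg : ∀ x, g x = e (matrixClass fun k => x.1 (finProdFinEquiv k)))
    (pStar : ParamIndex (m + 2) → (matrixCode m F).Dom q) (hpStar : ∀ i, g (pStar i) = p i) :
    DefinesComposite (fieldCode m (PT (m + 2) F)) (matrixCode m F) (fieldIsoFormula m F)
      f g pStar := by
  intro x a
  refine ((defPred_cornerRatio m F).choose_spec _).trans ?_
  change CornerRatio (fun k => (unitParam pStar).1 (finProdFinEquiv k))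
    (fun k => x (0 : Fin 1) (finProdFinEquiv k)) a ↔ _
  have hw : matrixClass (fun k => (unitParam pStar).1 (finProdFinEquiv k)) = corner u := by
    apply e.injective
    rw [← hp, ← hg]
    exact hpStar _
  rw [cornerRatio_iff h2 ((mem_matrixCode_dom q _).1 (unitParam pStar).2) hw]
  constructor
  · rintro ⟨hx, hxa⟩
    have hxd : ∀ i, x i ∈ (matrixCode m F).Dom q := fun i => by
      rw [Subsingleton.elim (α := Fin 1) i 0]
      exact (mem_matrixCode_dom q _).2 hx
    refine ⟨hxd, (mem_fieldCode_dom p _).2 ?_, ?_⟩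
    · rw [hg, centralizesComm_map_iff, hxa]
      exact (centralizesComm_iff h2).2 ⟨_, rfl⟩
    · rw [hf]
      simp only [hg]
      rw [e.symm_apply_apply, hxa, cornerEntry_corner h2, mul_div_cancel_right₀ _ hu]
  · rintro ⟨hx, hx', rfl⟩
    refine ⟨(mem_matrixCode_dom q _).1 (hx (0 : Fin 1)), ?_⟩
    have h := (mem_fieldCode_dom p _).1 hx'
    rw [hg, centralizesComm_map_iff, centralizesComm_iff h2] at h
    obtain ⟨b, hb⟩ := h
    simp only at hb
    rw [hf]
    simp only [hg]
    rw [e.symm_apply_apply, hb, cornerEntry_corner h2, div_mul_cancel₀ _ hu]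

/-- The twist `σ` in `f` is undone by `σ.symm` in `g`; what remains sends a tuple `cornerTuple u M`
to `e` of the class of `M`, whose graph is `Represents p`. -/
theorem definesComposite_group (h2 : (2 : F) ≠ 0) {p : ParamIndex (m + 2) → PT (m + 2) F}
    (e : PT (m + 2) F ≃* PT (m + 2) F) {u : F} (hu : u ≠ 0)
    (he : ∀ M y, Represents p (cornerTuple u M) y ↔ e (QuotientGroup.mk M) = y) (σ : F ≃+* F)
    {f : (fieldCode m (PT (m + 2) F)).Dom p → F}
    (hf : ∀ x, f x = σ (cornerEntry (x.1 (0 : Fin 1)) / u))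
    (qStar : Empty → (fieldCode m (PT (m + 2) F)).Dom p) {q : Empty → F}
    {g : (matrixCode m F).Dom q → PT (m + 2) F}
    (hg : ∀ x, g x = e (matrixClass fun k => σ.symm (x.1 (finProdFinEquiv k)))) :
    DefinesComposite (matrixCode m F) (fieldCode m (PT (m + 2) F)) (groupIsoFormula m F)
      g f qStar := by
  intro x y
  refine ((defPred_represents m (PT (m + 2) F)).choose_spec _).trans ?_
  change Represents p (fun k => x (finProdFinEquiv k) (0 : Fin 1)) y ↔ _
  constructor
  · intro h
    obtain ⟨M, hM⟩ := (triTuple_iff h2 hu).1 h.1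
    rw [hM, he] at h
    have hM' : ∀ k, x (finProdFinEquiv k) (0 : Fin 1) = corner (u * entryTuple M k) := congrFun hM
    have hxd : ∀ i, x i ∈ (fieldCode m (PT (m + 2) F)).Dom p := fun i => by
      refine (mem_fieldCode_dom p _).2 ?_
      obtain ⟨k, rfl⟩ := finProdFinEquiv.surjective i
      exact (centralizesComm_iff h2).2 ⟨_, hM' k⟩
    have hfx : ∀ k, f ⟨x (finProdFinEquiv k), hxd _⟩ = σ (entryTuple M k) := fun k => by
      rw [hf]
      change σ (cornerEntry (x (finProdFinEquiv k) (0 : Fin 1)) / u) = _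
      rw [hM', cornerEntry_corner h2, mul_div_cancel_left₀ _ hu]
    refine ⟨hxd, (mem_matrixCode_dom q _).2 ?_, ?_⟩
    · simp only [hfx]
      exact ⟨fun i j hij => (map_eq_zero σ).2 ((triMatrix_entryTuple M).1 i j hij),
        fun i => (map_ne_zero σ).2 ((triMatrix_entryTuple M).2 i)⟩
    · rw [hg]
      simp only [hfx, RingEquiv.symm_apply_apply]
      rw [matrixClass_entryTuple, h]
  · rintro ⟨hxd, hx', rfl⟩
    choose a ha using fun i => (centralizesComm_iff h2).1 ((mem_fieldCode_dom p (x i)).1 (hxd i))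
    have hfx : ∀ i, f ⟨x i, hxd i⟩ = σ (a i / u) := fun i => by
      rw [hf]
      change σ (cornerEntry (x i (0 : Fin 1)) / u) = _
      rw [ha, cornerEntry_corner h2]
    have hfx' : (fun k => f ⟨x (finProdFinEquiv k), hxd _⟩) =
        fun k : Fin (m + 2) × Fin (m + 2) => σ (a (finProdFinEquiv k) / u) :=
      funext fun k => hfx _
    have htri := (mem_matrixCode_dom q _).1 hx'
    rw [hfx'] at htri
    have htri' : TriMatrix fun k : Fin (m + 2) × Fin (m + 2) => a (finProdFinEquiv k) / u :=
      ⟨fun i j hij => (map_eq_zero σ).1 (htri.1 i j hij),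
        fun i => (map_ne_zero σ).1 (htri.2 i)⟩
    obtain ⟨M, hM⟩ := triMatrix_iff.1 htri'
    have hx : (fun k => x (finProdFinEquiv k) (0 : Fin 1)) = cornerTuple u M := by
      funext k
      refine (ha (finProdFinEquiv k)).trans ?_
      change _ = corner (u * entryTuple M k)
      rw [← hM, mul_div_cancel₀ _ hu]
    have hfM : (fun k => σ.symm (f ⟨x (finProdFinEquiv k), hxd _⟩)) = entryTuple M := by
      rw [← hM]
      exact funext fun k => (congrArg σ.symm (hfx _)).trans (σ.symm_apply_apply _)
    rw [hx, he, hg, ← matrixClass_entryTuple, ← hfM]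

theorem isRegularBiinterpretation (h2 : (2 : F) ≠ 0) {φ : groupLang.Formula (ParamIndex (m + 2))}
    (hφ : ∀ p : ParamIndex (m + 2) → PT (m + 2) F, φ.Realize p ↔ GoodParams p) :
    IsRegularBiinterpretation F (PT (m + 2) F) (fieldCode m (PT (m + 2) F)) φ (matrixCode m F) ⊤
      (fieldIsoFormula m F) (groupIsoFormula m F) where
  interpA := by
    refine ⟨⟨_, (hφ _).2 (goodParams_params h2)⟩, fun p hp => ?_⟩
    obtain ⟨u, hu, hpu, -⟩ := ((hφ p).1 hp).exists_mulEquiv h2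
    exact ⟨_, isCoordinateMap_fieldCode h2 hu hpu⟩
  interpB := ⟨⟨Empty.elim, by simp⟩, fun q _ => ⟨_, isCoordinateMap_matrixCode h2 q⟩⟩
  definableA q _ g hg pStar hp := by
    -- The given `g` is the standard map followed by an automorphism `e`; pulling the parameters
    -- back along `e` gives a unit `corner u`.
    obtain ⟨e, he⟩ := (isCoordinateMap_matrixCode h2 q).exists_equiv hg
    have hgood := (hφ _).1 hp
    obtain ⟨u, hu⟩ := (centralizesComm_iff h2).1
      (hgood.centralizes.map (mulEquivOfEquiv e).symm)
    have hu' : unitParam (fun i => g (pStar i)) = mulEquivOfEquiv e (corner u) := by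
      rw [← hu, MulEquiv.apply_symm_apply]
    have hu0 : u ≠ 0 := by
      rintro rfl
      rw [corner_zero, map_one] at hu'
      exact hgood.ne_one hu'
    have hf : (fieldCode m (PT (m + 2) F)).IsCoordinateMap (fun i => g (pStar i))
        (fun x => cornerEntry ((mulEquivOfEquiv e).symm (x.1 (0 : Fin 1))) / u) :=
      InterpCode.IsCoordinateMap.precomp (equivOfMulEquiv (mulEquivOfEquiv e).symm)
        (Γ := fieldCode m (PT (m + 2) F)) (p := fun i => g (pStar i))
        (μ := fun x : Fin 1 → PT (m + 2) F => cornerEntry (x 0) / u)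
        (isCoordinateMap_fieldCode h2 hu0
          (p := fun i => (mulEquivOfEquiv e).symm (g (pStar i))) hu)
    exact ⟨_, hf, definesComposite_field h2 (mulEquivOfEquiv e) hu0 hu' (fun _ => rfl) he pStar
      fun _ => rfl⟩
  definableB p hp f hf qStar _ := by
    obtain ⟨u, hu, hpu, e, he, -⟩ := ((hφ p).1 hp).exists_mulEquiv h2
    -- The given `f` is the standard map followed by a field automorphism, which the new `g` must
    -- undo on matrix entries.
    obtain ⟨σ, hσ⟩ := (isCoordinateMap_fieldCode h2 hu hpu).exists_equiv hf
    let τ : F ≃+* F := FirstOrder.Ring.languageEquivEquivRingEquiv σ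
    have hg : (matrixCode m F).IsCoordinateMap (fun j => f (qStar j))
        (fun x => equivOfMulEquiv e (matrixClass fun k => τ.symm (x.1 (finProdFinEquiv k)))) :=
      InterpCode.IsCoordinateMap.precomp
        (FirstOrder.Ring.languageEquivEquivRingEquiv.symm τ.symm)
        (Γ := matrixCode m F) (p := fun j => f (qStar j))
        (μ := fun x : Fin ((m + 2) * (m + 2)) → F =>
          equivOfMulEquiv e (matrixClass fun k => x (finProdFinEquiv k)))
        ((isCoordinateMap_matrixCode h2 _).postcomp (equivOfMulEquiv e))
    exact ⟨_, hg, definesComposite_group h2 e hu he τ hσ qStar fun _ => rfl⟩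
  coherent p q hp _ := by
    obtain ⟨u, hu, hpu, e, he, hec⟩ := ((hφ p).1 hp).exists_mulEquiv h2
    have hf := isCoordinateMap_fieldCode h2 hu hpu
    have hg := (isCoordinateMap_matrixCode h2 q).postcomp (equivOfMulEquiv e)
    refine ⟨_, _, hf, hg, fun pStar hpStar => ?_, fun qStar _ => ?_⟩
    · refine definesComposite_field h2 e one_ne_zero ?_ (fun x => ?_) (fun _ => rfl) pStar hpStar
      · rw [hpu, hec, mul_one]
      · obtain ⟨a, ha⟩ := (centralizesComm_iff h2).1 ((mem_fieldCode_dom p x.1).1 x.2)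
        have : x.1 (0 : Fin 1) = e (corner (a / u)) := by
          rw [ha, hec, mul_div_cancel₀ _ hu]
        rw [this, e.symm_apply_apply, ← this, ha, cornerEntry_corner h2, cornerEntry_corner h2,
          div_one]
    · exact definesComposite_group h2 e hu he (RingEquiv.refl F) (fun _ => rfl) qStar
        fun _ => rfl

end Composites

/-! ### The semidirect product decomposition -/

section Decomposition

variable {m : ℕ} {F : Type*} [Field F]

/-- The generators lie in the image of the tuples with last entry 1; conversely such a tuple is the
product of its single-entry factors, the last one trivial. -/
theorem mem_B_iff {g : T (m + 2) F} :
    g ∈ B (m + 2) F ↔ ∃ α : Fin (m + 2) → Fˣ, α (Fin.last _) = 1 ∧ g = diag α := by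
  constructor
  · intro hg
    have hle : B (m + 2) F ≤ ((Pi.evalMonoidHom (fun _ : Fin (m + 2) => Fˣ)
        (Fin.last _)).ker).map (diagHom (m + 2) F) := by
      refine (Subgroup.closure_le _).2 ?_
      rintro _ ⟨i, α, hi, rfl⟩
      refine ⟨Pi.mulSingle i α, ?_, rfl⟩
      have : Fin.last (m + 1) ≠ i := by
        rintro rfl
        simp at hi
      exact Pi.mulSingle_eq_of_ne (M := fun _ => Fˣ) this α
    obtain ⟨α, hα, rfl⟩ := hle hg
    exact ⟨α, hα, rfl⟩
  · rintro ⟨α, hα, rfl⟩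
    have hmem : α ∈ (B (m + 2) F).comap (diagHom (m + 2) F) := by
      rw [← Finset.univ_prod_mulSingle α]
      refine Subgroup.prod_mem _ fun i _ => ?_
      by_cases hi : i = Fin.last _
      · rw [hi, hα, Pi.mulSingle_one]
        exact one_mem _
      · refine Subgroup.subset_closure ⟨i, α i, ?_, rfl⟩
        have : (i : ℕ) < m + 1 := Fin.lt_last_iff_ne_last.2 hi
        omega
    exact hmem

/-- Each class modulo scalars has exactly one representative with last diagonal entry 1, and it
factors uniquely as unitriangular times diagonal. -/
theorem exists_semidirect_mulEquiv (h2 : (2 : F) ≠ 0) :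
    ∃ e : UT (m + 2) F ⋊[(MulAut.conjNormal (H := UT (m + 2) F)).comp (B (m + 2) F).subtype]
        B (m + 2) F ≃* PT (m + 2) F,
      ∀ x, e x = QuotientGroup.mk ((x.left : T (m + 2) F) * (x.right : T (m + 2) F)) := by
  let f : UT (m + 2) F ⋊[(MulAut.conjNormal (H := UT (m + 2) F)).comp (B (m + 2) F).subtype]
      B (m + 2) F →* PT (m + 2) F :=
    MonoidHom.mk' (fun x => QuotientGroup.mk ((x.left : T (m + 2) F) * (x.right : T (m + 2) F)))
      (fun x y => by
        rw [← QuotientGroup.mk_mul]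
        refine congrArg QuotientGroup.mk ?_
        simp only [SemidirectProduct.mul_left, SemidirectProduct.mul_right, Subgroup.coe_mul,
          MonoidHom.comp_apply, Subgroup.subtype_apply, MulAut.conjNormal_apply]
        group)
  refine ⟨MulEquiv.ofBijective f ⟨?_, ?_⟩, fun x => rfl⟩
  · rw [injective_iff_map_eq_one]
    intro x hx
    obtain ⟨α, hα, hb⟩ := mem_B_iff.1 x.right.2
    have hx' : (QuotientGroup.mk ((x.left : T (m + 2) F) * (x.right : T (m + 2) F)) :
      PT (m + 2) F) = 1 := hx
    rw [QuotientGroup.eq_one_iff, hb, mem_center_iff_scalar h2] at hx'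
    have hd : ∀ i, (α i : F) = entry (x.left.1 * diag α) i i := fun i => by
      rw [entry_mul_diag', UT_entry x.left.2, one_mul]
    have hα1 : α = 1 := by
      funext i
      apply Units.ext
      rw [hd, hx', if_pos rfl]
      have := hd (Fin.last _)
      rw [hx', if_pos rfl, hα] at this
      exact this.symm
    have hb1 : x.right = 1 := by
      apply Subtype.ext
      rw [hb, hα1]
      exact map_one (diagHom (m + 2) F)
    have hl1 : x.left = 1 := by
      apply Subtype.ext
      refine T_ext fun i j => ?_
      have := hx' i j
      rw [entry_mul_diag', ← hd 0, hα1] at this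
      simpa [entry_one] using this
    exact SemidirectProduct.ext hl1 hb1
  · intro y
    obtain ⟨M, rfl⟩ := QuotientGroup.mk_surjective y
    have hM := entry_diag_ne_zero M
    -- `α` is the diagonal of `M`, and `β` is `α` rescaled to end in 1; the product of the two
    -- factors is `M` divided by its last diagonal entry.
    let α : Fin (m + 2) → Fˣ := fun i => Units.mk0 (entry M i i) (hM i)
    let β : Fin (m + 2) → Fˣ := fun i => α i * (α (Fin.last _))⁻¹
    have hu : M * diag α⁻¹ ∈ UT (m + 2) F := by
      rw [UT, MonoidHom.mem_ker]
      funext i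
      change entry (M * diag α⁻¹) i i = 1
      rw [entry_mul_diag']
      exact (α i).mul_inv
    refine ⟨⟨⟨_, hu⟩, ⟨diag β, mem_B_iff.2 ⟨β, mul_inv_cancel _, rfl⟩⟩⟩, ?_⟩
    change QuotientGroup.mk (M * diag α⁻¹ * diag β) = _
    rw [eq_comm, mk_eq_mk_iff h2]
    refine ⟨((α (Fin.last _))⁻¹ : Fˣ), Units.ne_zero _, fun i j => ?_⟩
    rw [entry_mul_diag', entry_mul_diag', mul_assoc, ← Units.val_mul, mul_comm]
    congr 2
    simp [β]

end Decomposition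

end TriBi

theorem mainTheorem9 {F : Type*} [Field F] [Infinite F] (hF : ringChar F ≠ 2)
    (n : ℕ) (hn : 3 ≤ n) :
    (∃ e : TriBi.UT n F ⋊[(MulAut.conjNormal (H := TriBi.UT n F)).comp (TriBi.B n F).subtype]
          TriBi.B n F ≃* TriBi.PT n F,
      ∀ x, e x = QuotientGroup.mk ((x.left : TriBi.T n F) * (x.right : TriBi.T n F))) ∧
    ∃ (Γ : TriBi.InterpCode FirstOrder.Language.ring TriBi.groupLang (TriBi.ParamIndex n))
      (φ : TriBi.groupLang.Formula (TriBi.ParamIndex n))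
      (Δ : TriBi.InterpCode TriBi.groupLang FirstOrder.Language.ring Empty)
      (ψ : FirstOrder.Language.ring.Formula Empty)
      (θF : FirstOrder.Language.ring.Formula (((TriBi.ParamIndex n × Fin Δ.dim) ⊕ Empty) ⊕
        ((Fin Γ.dim × Fin Δ.dim) ⊕ Unit)))
      (θG : TriBi.groupLang.Formula (((Empty × Fin Γ.dim) ⊕ TriBi.ParamIndex n) ⊕
        ((Fin Δ.dim × Fin Γ.dim) ⊕ Unit))),
      TriBi.IsRegularBiinterpretation F (TriBi.PT n F) Γ φ Δ ψ θF θG ∧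
        φ.Realize (TriBi.params n F) := by
  have h2 : (2 : F) ≠ 0 := Ring.two_ne_zero hF
  -- In `Fin (m + 2)` the indices `0` and `Fin.last _` are distinct, so the corner lies strictly
  -- above the diagonal.
  obtain ⟨m, rfl⟩ : ∃ m, n = m + 2 := ⟨n - 2, by omega⟩
  obtain ⟨φ, hφ⟩ := TriBi.defPred_goodParams (m := m) (G := TriBi.PT (m + 2) F)
  exact ⟨TriBi.exists_semidirect_mulEquiv h2, _, φ, _, _, _, _,
    TriBi.isRegularBiinterpretation h2 hφ, (hφ _).2 (TriBi.goodParams_params h2)⟩
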